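/- **Theorem (Approximation for $\mu_0$-coherent matrices).** Conventions: two matrices $A,A'\in\mathbb R^{m\times n}$ are neighboring if they differ in at most one row, and there by a vector of Euclidean norm at most $1$; a randomized algorithm $M$ is $(\epsilon,\delta)$-differentially private if $\Pr[M(A)\in S]\le e^{\epsilon}\Pr[M(A')\in S]+\delta$ for all neighboring $A,A'$ and all measurable sets $S$ of outputs. $A_r$ is an optimal approximation of $A$ of rank at most $r$ in the Frobenius norm $\|\cdot\|_F$. For a matrix $A\in\mathbb R^{m\times n}$ of rank $R$ with singular value decomposition $A=U\Sigma V^T$, $U\in\mathbb R^{m\times R}$, we put $\mu_0(A)=\frac mR\max_{j}\|UU^Te_j\|^2$. There are absolute constants $c_0,C>0$ and a randomized algorithm that receives a matrix $A\in\mathbb R^{m\times n}$, integers $r\ge2$, $p\ge2$ and privacy parameters $\epsilon,\delta\in(0,1)$ (but neither the rank nor the coherence of $A$ as parameters), is $(\epsilon,\delta)$-differentially private, and has the following properties. Write $k=r+p$, $R=\operatorname{rank}(A)$ and $L=\log(k/\delta)$, and assume $k\le R$. 1. If $m\ge c_0\,Rk\log R$, then the output $B$ almost surely has rank $k$, and with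 probability at least $9/10$, $$\|A-B\|_F\le C\left(\sqrt{1+\frac r{p-1}}\;\|A-A_r\|_F+\left(\sqrt{km}+\sqrt{\frac{kR\mu_0(A)+k^2\log m}{m}}\,\sqrt{kn}\right)\frac{\log(k/\delta)}{\epsilon}\right).$$ 2. Along any family of inputs (all the parameters and $A$ may vary) with $$m=o(n)\quad\text{and}\quad Rk(\mu_0(A)+\log m)\sqrt{L}=o(m),$$ one has eventually, with probability at least $9/10$, $\|A-B\|_F\le C\sqrt{1+\frac r{p-1}}\,\|A-A_r\|_F+\eta$ with $\eta=o\big(\sqrt{kn}\,L/\epsilon\big)$. 3. If moreover $mL=o(n)$ and $Rk(\mu_0(A)+\log m)\,L=o(m)$, then the same holds with $\eta=o\big(\sqrt{kn\,L}/\epsilon\big)$, so that this error term is of smaller order than that of randomized response. -/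

import Mathlib

open MeasureTheory ProbabilityTheory Filter Asymptotics

noncomputable section

namespace PrivateLowRank

/-- The Borel sigma-algebra on the space of real `m × n` matrices (the product one). -/
instance matrixMeasurableSpace (m n : ℕ) : MeasurableSpace (Matrix (Fin m) (Fin n) ℝ) :=
  inferInstanceAs (MeasurableSpace (Fin m → Fin n → ℝ))

/-- The Frobenius norm `‖A‖_F`. -/
def frobNorm {m n : ℕ} (A : Matrix (Fin m) (Fin n) ℝ) : ℝ :=
  Real.sqrt (∑ i, ∑ j, A i j ^ 2)

/-- `‖A - A_r‖_F`, where `A_r` is an optimal approximation of `A` of rank at most `r`: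
the least Frobenius distance from `A` to a matrix of rank at most `r`. -/
def bestRankError {m n : ℕ} (A : Matrix (Fin m) (Fin n) ℝ) (r : ℕ) : ℝ :=
  sInf {d : ℝ | ∃ X : Matrix (Fin m) (Fin n) ℝ, X.rank ≤ r ∧ d = frobNorm (A - X)}

/-- The range (column space) of `A`, which is the span of its left singular vectors. -/
def colSpace {m n : ℕ} (A : Matrix (Fin m) (Fin n) ℝ) :
    Submodule ℝ (EuclideanSpace ℝ (Fin m)) :=
  LinearMap.range (Matrix.toEuclideanLin A)

/-- The `μ₀`-coherence of a matrix `A` of rank `R`: `(m / R) * max_j ‖P_U e_j‖ ^ 2`, where `P_U`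
is the orthogonal projection onto the span of the left singular vectors of `A`. -/
def mu0 {m n : ℕ} (A : Matrix (Fin m) (Fin n) ℝ) : ℝ :=
  (m : ℝ) / (A.rank : ℝ) *
    ⨆ j : Fin m, ‖(colSpace A).starProjection (EuclideanSpace.single j (1 : ℝ))‖ ^ 2

/-- Two matrices are neighboring if they differ in at most one row, by a vector of Euclidean norm
at most one. -/
def Neighboring {m n : ℕ} (A A' : Matrix (Fin m) (Fin n) ℝ) : Prop :=
  ∃ i : Fin m, Real.sqrt (∑ j, (A i j - A' i j) ^ 2) ≤ 1 ∧ ∀ i', i' ≠ i → ∀ j, A i' j = A' i' j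

/-- A randomized algorithm, mapping an `m × n` matrix to the law of its random `m × n` output, is
`(ε, δ)`-differentially private. -/
def IsDP {m n : ℕ} (ε δ : ℝ)
    (M : Kernel (Matrix (Fin m) (Fin n) ℝ) (Matrix (Fin m) (Fin n) ℝ)) : Prop :=
  ∀ A A' : Matrix (Fin m) (Fin n) ℝ, Neighboring A A' →
    ∀ S : Set (Matrix (Fin m) (Fin n) ℝ), MeasurableSet S →
      M A S ≤ ENNReal.ofReal (Real.exp ε) * M A' S + ENNReal.ofReal δ

/-- An input matrix with the parameters of the algorithm: target rank `r`, oversampling `p`,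
privacy parameters `ε`, `δ`. -/
structure Instance where
  (m n r p : ℕ)
  (ε δ : ℝ)
  A : Matrix (Fin m) (Fin n) ℝ
  two_le_r : 2 ≤ r
  two_le_p : 2 ≤ p
  ε_pos : 0 < ε
  ε_lt_one : ε < 1
  δ_pos : 0 < δ
  δ_lt_one : δ < 1
  le_rank : r + p ≤ A.rank

namespace Instance

/-- The rank of the output, `k = r + p`. -/
def k (I : Instance) : ℕ := I.r + I.p

/-- The rank `R` of the input matrix. -/
def R (I : Instance) : ℕ := I.A.rank

/-- The quantity `log (k / δ)`. -/
def L (I : Instance) : ℝ := Real.log ((I.k : ℝ) / I.δ)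

/-- `√(1 + r / (p - 1)) * ‖A - A_r‖_F` -/
def approxTerm (I : Instance) : ℝ :=
  Real.sqrt (1 + (I.r : ℝ) / ((I.p : ℝ) - 1)) * bestRankError I.A I.r

/-- `(√(k m) + √((k R μ₀(A) + k² log m) / m) * √(k n)) * log (k / δ) / ε` -/
def noiseTerm (I : Instance) : ℝ :=
  (Real.sqrt ((I.k : ℝ) * I.m) +
      Real.sqrt (((I.k : ℝ) * I.R * mu0 I.A + (I.k : ℝ) ^ 2 * Real.log I.m) / I.m) *
        Real.sqrt ((I.k : ℝ) * I.n)) * (I.L / I.ε)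

end Instance

/-- A randomized algorithm receiving `r`, `p`, `ε`, `δ` and an `m × n` matrix, given by the laws of
its outputs. -/
abbrev Algorithm : Type :=
  ∀ (m n _r _p : ℕ) (_ε _δ : ℝ),
    Kernel (Matrix (Fin m) (Fin n) ℝ) (Matrix (Fin m) (Fin n) ℝ)

/-- The law of the output of `M` on the instance `I`. -/
def Algorithm.output (M : Algorithm) (I : Instance) : Measure (Matrix (Fin I.m) (Fin I.n) ℝ) :=
  M I.m I.n I.r I.p I.ε I.δ I.A

/-- The output `B` of `M` on `I` satisfies `‖A - B‖_F ≤ t` with probability at least `9/10`. -/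
def Algorithm.HasError (M : Algorithm) (I : Instance) (t : ℝ) : Prop :=
  9 / 10 ≤ (M.output I).real {B | frobNorm (I.A - B) ≤ t}

/-- The definition of `mu0` in terms of a singular value decomposition `A = U Σ Vᵀ`. -/
theorem mu0_eq_of_svd {m n R : ℕ} {A : Matrix (Fin m) (Fin n) ℝ}
    {U : Matrix (Fin m) (Fin R) ℝ} {V : Matrix (Fin n) (Fin R) ℝ} {σ : Fin R → ℝ}
    (hU : U.transpose * U = 1) (hV : V.transpose * V = 1) (hσ : ∀ i, 0 < σ i)
    (hA : A = U * Matrix.diagonal σ * V.transpose) :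
    mu0 A = (m : ℝ) / R * ⨆ j : Fin m, ∑ i, U j i ^ 2 := by
  have hrange : colSpace A = LinearMap.range (Matrix.toEuclideanLin U) := by
    apply le_antisymm
    · rintro _ ⟨x, rfl⟩
      refine ⟨WithLp.toLp 2 ((Matrix.diagonal σ * V.transpose).mulVec x.ofLp), ?_⟩
      rw [Matrix.toLpLin_apply, Matrix.toLpLin_apply, hA, Matrix.mul_assoc]
      simp [Matrix.mulVec_mulVec]
    · rintro _ ⟨x, rfl⟩
      refine ⟨WithLp.toLp 2 ((V * Matrix.diagonal (fun i => (σ i)⁻¹)).mulVec x.ofLp), ?_⟩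
      have hd : Matrix.diagonal σ * Matrix.diagonal (fun i => (σ i)⁻¹) =
          (1 : Matrix (Fin R) (Fin R) ℝ) := by
        rw [Matrix.diagonal_mul_diagonal, ← Matrix.diagonal_one]
        congr 1
        funext i
        exact mul_inv_cancel₀ (hσ i).ne'
      have h : U * Matrix.diagonal σ * V.transpose *
          (V * Matrix.diagonal (fun i => (σ i)⁻¹)) = U := by
        calc _ = U * (Matrix.diagonal σ * (V.transpose * V) *
              Matrix.diagonal (fun i => (σ i)⁻¹)) := by simp only [Matrix.mul_assoc]
          _ = U := by rw [hV, Matrix.mul_one, hd, Matrix.mul_one]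
      rw [Matrix.toLpLin_apply, Matrix.toLpLin_apply, hA]
      simp only [Matrix.mulVec_mulVec, h]
  have hUinj : Function.Injective (Matrix.toEuclideanLin U) := by
    intro x y hxy
    have h1 := congrArg (fun z : EuclideanSpace ℝ (Fin m) => U.transpose.mulVec z.ofLp) hxy
    simp only [Matrix.toLpLin_apply, Matrix.mulVec_mulVec, hU, Matrix.one_mulVec] at h1
    exact WithLp.ofLp_injective 2 h1
  have hrank : A.rank = R := by
    have h1 : A.rank = Module.finrank ℝ (colSpace A) := by
      rw [colSpace, Matrix.rank_eq_finrank_range_toLin A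
        (EuclideanSpace.basisFun (Fin m) ℝ).toBasis (EuclideanSpace.basisFun (Fin n) ℝ).toBasis]
      rfl
    rw [h1, hrange, LinearMap.finrank_range_of_inj hUinj]
    simp
  have hproj : ∀ j : Fin m,
      (colSpace A).starProjection (EuclideanSpace.single j (1 : ℝ)) =
        Matrix.toEuclideanLin U (WithLp.toLp 2 (fun i => U j i)) := by
    intro j
    apply Submodule.eq_starProjection_of_mem_of_inner_eq_zero
    · rw [hrange]
      exact ⟨_, rfl⟩
    · intro w hw
      rw [hrange] at hw
      obtain ⟨x, rfl⟩ := hw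
      have hj : (fun i => U j i) = U.transpose.mulVec (Pi.single j 1) := by
        funext i
        simp
      have key : U.transpose.mulVec (Pi.single j 1 - U.mulVec (fun i => U j i)) = 0 := by
        rw [Matrix.mulVec_sub, Matrix.mulVec_mulVec, hU, Matrix.one_mulVec, hj, sub_self]
      rw [EuclideanSpace.inner_eq_star_dotProduct]
      simp only [Matrix.toLpLin_apply, star_trivial]
      have h2 : (EuclideanSpace.single j (1 : ℝ) -
          WithLp.toLp 2 (U.mulVec (fun i => U j i)) : EuclideanSpace ℝ (Fin m)).ofLp =
          Pi.single j 1 - U.mulVec (fun i => U j i) := by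
        simp
      rw [h2, dotProduct_comm, Matrix.dotProduct_mulVec, ← Matrix.mulVec_transpose, key,
        zero_dotProduct]
  have hnorm : ∀ j : Fin m,
      ‖(colSpace A).starProjection (EuclideanSpace.single j (1 : ℝ))‖ ^ 2 = ∑ i, U j i ^ 2 := by
    intro j
    rw [hproj j, Matrix.toLpLin_apply, EuclideanSpace.real_norm_sq_eq]
    have h3 : ∀ u : Fin R → ℝ, (U.mulVec u) ⬝ᵥ (U.mulVec u) = u ⬝ᵥ u := by
      intro u
      rw [Matrix.dotProduct_mulVec, ← Matrix.mulVec_transpose, Matrix.mulVec_mulVec, hU,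
        Matrix.one_mulVec]
    have h4 := h3 (fun i => U j i)
    simp only [dotProduct, ← pow_two] at h4
    exact h4
  rw [mu0, hrank]
  simp only [hnorm]

end PrivateLowRank

end

/-!
The algorithm has two phases, both based on the Gaussian mechanism. With `k = r + p` and `l` of
order `k log k`, it forms a noisy sketch `Y = A Ω + σ N`, where `Ω` (of size `n × l`) and `N` are
Gaussian matrices, and then projects a noisy copy of `A` to the column space of `Y`. Since the
projection `P` is already public in the second phase, changing row `i` of `A` by a unit vector
changes `P A` only by `‖P eᵢ‖`, so that the noise there can be scaled by `maxᵢ ‖P eᵢ‖`. Finally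
the result is moved to a nearby matrix of rank exactly `k`, chosen measurably from a countable
dense set.

*Privacy.* A Gaussian vector and its translate by `w` are indistinguishable if `‖w‖` is small
(`lintegral_stdGaussian_translate_le`, from the explicit density). In the first phase the
translation is by a multiple of a row `uᵀ Ω` with `‖u‖ ≤ 1`, which is short except with probability
`δ / 4` by a chi-square tail bound; in the second one it is controlled by the choice of the noise
level. The two phases are composed in `mechanism_isDP`.

*Utility.* Both parts rest on `gaussianMatrix_sum_mulVec_sq_ge`, a lower bound for the smallest
singular value of a tall Gaussian matrix. A union bound over a cubical grid suffices, because
oversampling by a factor `log k` is affordable: it is absorbed by `L = log (k / δ) ≥ log k`.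
Let `X` be a matrix of rank `k` that is no further from `A` than an almost optimal matrix of rank
at most `r`. As `Ω` is well conditioned on the row space of `X`, there is a matrix `S` with
`X Ω S = X`, and `‖A - P A‖ ≤ ‖A - Y S‖` is at most a constant times `‖A - X‖ + σ √m`
(`frobNorm_sub_colProj_sketch_le`). The column space of `Y` lies in the sum of those of `A` and `N`.
As `N` is well conditioned on the orthogonal complement of the former, `‖P eᵢ‖` is at most of order
`√(R μ₀ / m) + √((l + log m) / m)` (`colProjWidth_sketch_le`). This gives the error bound
`Instance.algorithm_hasError`, and in the two asymptotic regimes its noise term is of the required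
smaller order (`Instance.noiseTerm_mul_sqrt_le`).
-/

namespace PrivateLowRank

open scoped RealInnerProductSpace ENNReal

/-! ### Standard Gaussian vectors -/

section Gaussian

variable {E : Type*} [NormedAddCommGroup E] [InnerProductSpace ℝ E] [FiniteDimensional ℝ E]
  [MeasurableSpace E] [BorelSpace E]

/-- The coordinates of a standard Gaussian vector along an orthonormal family are again a standard
Gaussian vector. -/
theorem stdGaussian_map_inner_orthonormal {κ : Type*} [Fintype κ] {e : κ → E}
    (he : Orthonormal ℝ e) :
    (stdGaussian E).map (fun g => WithLp.toLp 2 fun k => ⟪e k, g⟫) =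
      stdGaussian (EuclideanSpace ℝ κ) := by
  have hm : Measurable (fun g : E => (WithLp.toLp 2 fun k => ⟪e k, g⟫ : EuclideanSpace ℝ κ)) := by
    apply Continuous.measurable
    fun_prop
  have : IsProbabilityMeasure
      ((stdGaussian E).map (fun g => (WithLp.toLp 2 fun k => ⟪e k, g⟫ : EuclideanSpace ℝ κ))) :=
    Measure.isProbabilityMeasure_map hm.aemeasurable
  apply Measure.ext_of_charFun
  ext t
  have h1 : charFun ((stdGaussian E).map
      (fun g => (WithLp.toLp 2 fun k => ⟪e k, g⟫ : EuclideanSpace ℝ κ))) t =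
      charFun (stdGaussian E) (∑ k, t k • e k) := by
    rw [charFun_apply, charFun_apply, integral_map hm.aemeasurable
      (Measurable.aestronglyMeasurable (by fun_prop))]
    congr 1
    ext g
    congr 3
    simp [PiLp.inner_apply, inner_sum, real_inner_smul_right, real_inner_comm]
  have h2 : ‖∑ k, t k • e k‖ ^ 2 = ‖t‖ ^ 2 := by
    rw [← real_inner_self_eq_norm_sq, he.inner_sum, EuclideanSpace.real_norm_sq_eq]
    simp [pow_two]
  rw [h1, charFun_stdGaussian, charFun_stdGaussian]
  congr 2
  exact_mod_cast congrArg Neg.neg h2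

theorem lintegral_inner_sq_stdGaussian (v : E) :
    ∫⁻ g, ENNReal.ofReal (⟪v, g⟫ ^ 2) ∂(stdGaussian E) = ENNReal.ofReal (‖v‖ ^ 2) := by
  have h := variance_dual_stdGaussian (E := E) (innerSL ℝ v)
  have hL : MemLp (innerSL ℝ v) 2 (stdGaussian E) :=
    IsGaussian.memLp_dual (stdGaussian E) (innerSL ℝ v) 2 (by simp)
  rw [variance_eq_integral (by fun_prop), integral_strongDual_stdGaussian, innerSL_apply_norm] at h
  rw [← h, ofReal_integral_eq_lintegral_ofReal]
  · simp
  · simpa using hL.integrable_sq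
  · exact ae_of_all _ fun _ => by positivity

theorem lintegral_exp_inner_stdGaussian (v : E) :
    ∫⁻ g, ENNReal.ofReal (Real.exp ⟪v, g⟫) ∂(stdGaussian E) =
      ENNReal.ofReal (Real.exp (‖v‖ ^ 2 / 2)) := by
  have hmap : (stdGaussian E).map (innerSL ℝ v) = gaussianReal 0 (‖v‖ ^ 2).toNNReal := by
    rw [IsGaussian.map_eq_gaussianReal, integral_strongDual_stdGaussian,
      variance_dual_stdGaussian, innerSL_apply_norm]
  have h := mgf_gaussianReal hmap 1
  have hi : Integrable (fun x : ℝ => Real.exp (1 * x)) (gaussianReal 0 (‖v‖ ^ 2).toNNReal) :=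
    integrable_exp_mul_gaussianReal 1
  rw [← hmap] at hi
  have hi' := hi.comp_measurable (by fun_prop : Measurable (innerSL ℝ v))
  rw [mgf] at h
  rw [← ofReal_integral_eq_lintegral_ofReal]
  · simp only [innerSL_apply_apply, one_mul] at h
    rw [h]
    simp
  · simpa [Function.comp_def] using hi'
  · exact ae_of_all _ fun _ => by positivity

theorem lintegral_exp_sq_gaussianReal {t : ℝ} (ht : t < 1 / 2) :
    ∫⁻ x, ENNReal.ofReal (Real.exp (t * x ^ 2)) ∂(gaussianReal 0 1) =
      ENNReal.ofReal (Real.sqrt (1 / (1 - 2 * t))) := by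
  rw [gaussianReal_of_var_ne_zero _ one_ne_zero,
    lintegral_withDensity_eq_lintegral_mul _ (by fun_prop) (by fun_prop)]
  have hb : 0 < 1 / 2 - t := by linarith
  have h1 : ∀ x : ℝ, (gaussianPDF 0 1 * fun x => ENNReal.ofReal (Real.exp (t * x ^ 2))) x =
      ENNReal.ofReal ((Real.sqrt (2 * Real.pi))⁻¹ * Real.exp (-(1 / 2 - t) * x ^ 2)) := by
    intro x
    rw [Pi.mul_apply, gaussianPDF, ← ENNReal.ofReal_mul (gaussianPDFReal_nonneg _ _ _),
      gaussianPDFReal, mul_assoc, ← Real.exp_add]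
    simp only [NNReal.coe_one, mul_one, sub_zero]
    congr 3
    ring
  simp_rw [h1]
  rw [← ofReal_integral_eq_lintegral_ofReal]
  · rw [integral_const_mul, integral_gaussian, ← Real.sqrt_inv, ← Real.sqrt_mul (by positivity)]
    congr 2
    have : Real.pi ≠ 0 := Real.pi_ne_zero
    have h3 : 1 - 2 * t ≠ 0 := by linarith
    have h4 : 1 / 2 - t ≠ 0 := by linarith
    field_simp
  · exact (integrable_exp_neg_mul_sq hb).const_mul _
  · exact ae_of_all _ fun _ => by positivity

theorem lintegral_pi_prod {κ : Type*} [Fintype κ] (μ : κ → Measure ℝ)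
    [∀ k, IsProbabilityMeasure (μ k)] (f : κ → ℝ → ℝ≥0∞) (hf : ∀ k, Measurable (f k)) :
    ∫⁻ x, ∏ k, f k (x k) ∂(Measure.pi μ) = ∏ k, ∫⁻ x, f k x ∂(μ k) := by
  have hi : iIndepFun (fun k (x : κ → ℝ) => f k (x k)) (Measure.pi μ) :=
    iIndepFun_pi (X := fun k => f k) fun k => (hf k).aemeasurable
  rw [lintegral_prod_eq_prod_lintegral_of_indepFun Finset.univ _ hi
    (fun k => (hf k).comp (measurable_pi_apply k))]
  refine Finset.prod_congr rfl fun k _ => ?_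
  exact (measurePreserving_eval μ k).lintegral_comp (hf k)

/-- The moment generating function of a chi-square variable. -/
theorem lintegral_exp_sum_inner_sq {κ : Type*} [Fintype κ] {e : κ → E} (he : Orthonormal ℝ e)
    {t : ℝ} (ht : t < 1 / 2) :
    ∫⁻ g, ENNReal.ofReal (Real.exp (t * ∑ k, ⟪e k, g⟫ ^ 2)) ∂(stdGaussian E) =
      ENNReal.ofReal (Real.sqrt (1 / (1 - 2 * t))) ^ Fintype.card κ := by
  have hm : Measurable (fun g : E => (WithLp.toLp 2 fun k => ⟪e k, g⟫ : EuclideanSpace ℝ κ)) := by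
    apply Continuous.measurable
    fun_prop
  have h1 : ∫⁻ g, ENNReal.ofReal (Real.exp (t * ∑ k, ⟪e k, g⟫ ^ 2)) ∂(stdGaussian E) =
      ∫⁻ x : EuclideanSpace ℝ κ, ENNReal.ofReal (Real.exp (t * ∑ k, x k ^ 2))
        ∂(stdGaussian (EuclideanSpace ℝ κ)) := by
    rw [← stdGaussian_map_inner_orthonormal he, lintegral_map (by fun_prop) hm]
  rw [h1, ← map_pi_eq_stdGaussian, lintegral_map (by fun_prop) (by fun_prop)]
  simp_rw [Finset.mul_sum, Real.exp_sum]
  simp_rw [ENNReal.ofReal_prod_of_nonneg (fun _ _ => (Real.exp_pos _).le)]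
  rw [lintegral_pi_prod _ (fun _ x => ENNReal.ofReal (Real.exp (t * x ^ 2)))
    (fun _ => by fun_prop)]
  simp [lintegral_exp_sq_gaussianReal ht]

theorem pi_withDensity_eq {κ : Type*} [Fintype κ] (μ : κ → Measure ℝ)
    [∀ k, IsProbabilityMeasure (μ k)] (f : κ → ℝ → ℝ≥0∞) (hf : ∀ k, Measurable (f k))
    [∀ k, IsProbabilityMeasure ((μ k).withDensity (f k))] :
    Measure.pi (fun k => (μ k).withDensity (f k)) =
      (Measure.pi μ).withDensity fun x => ∏ k, f k (x k) := by
  refine Measure.pi_eq fun s hs => ?_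
  rw [withDensity_apply _ (MeasurableSet.univ_pi hs)]
  have h1 : ∀ k, (μ k).withDensity (f k) (s k) = ∫⁻ x, (s k).indicator (f k) x ∂(μ k) := by
    intro k
    rw [withDensity_apply _ (hs k), lintegral_indicator (hs k)]
  simp_rw [h1]
  rw [← lintegral_pi_prod μ _ (fun k => (hf k).indicator (hs k)),
    ← lintegral_indicator (MeasurableSet.univ_pi hs)]
  congr 1
  ext x
  by_cases hx : x ∈ Set.univ.pi s
  · rw [Set.indicator_of_mem hx]
    exact Finset.prod_congr rfl fun k _ => (Set.indicator_of_mem (hx k trivial) _).symm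
  · rw [Set.indicator_of_notMem hx]
    simp only [Set.mem_pi, Set.mem_univ, true_implies, not_forall] at hx
    obtain ⟨k, hk⟩ := hx
    exact (Finset.prod_eq_zero (Finset.mem_univ k) (Set.indicator_of_notMem hk _)).symm

theorem gaussianReal_eq_withDensity (a : ℝ) :
    gaussianReal a 1 = (gaussianReal 0 1).withDensity
      fun x => ENNReal.ofReal (Real.exp (a * x - a ^ 2 / 2)) := by
  rw [gaussianReal_of_var_ne_zero _ one_ne_zero, gaussianReal_of_var_ne_zero _ one_ne_zero,
    ← withDensity_mul _ (by fun_prop) (by fun_prop)]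
  congr 1
  ext x
  rw [Pi.mul_apply, gaussianPDF, gaussianPDF, ← ENNReal.ofReal_mul (gaussianPDFReal_nonneg _ _ _),
    gaussianPDFReal, gaussianPDFReal, mul_assoc _ (Real.exp _) (Real.exp _), ← Real.exp_add]
  simp only [NNReal.coe_one, mul_one, sub_zero]
  congr 3
  ring

/-- The density of a translate of the standard Gaussian measure. -/
theorem stdGaussian_map_add_right {ι : Type*} [Fintype ι] (w : EuclideanSpace ℝ ι) :
    (stdGaussian (EuclideanSpace ℝ ι)).map (fun g => g + w) =
      (stdGaussian (EuclideanSpace ℝ ι)).withDensity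
        fun g => ENNReal.ofReal (Real.exp (⟪w, g⟫ - ‖w‖ ^ 2 / 2)) := by
  have hpi : (Measure.pi fun _ : ι => gaussianReal 0 1).map (fun x i => x i + w i) =
      (Measure.pi fun _ : ι => gaussianReal 0 1).withDensity
        fun x => ∏ i, ENNReal.ofReal (Real.exp (w i * x i - w i ^ 2 / 2)) := by
    have hp : ∀ i : ι, IsProbabilityMeasure ((gaussianReal 0 1).withDensity
        fun x => ENNReal.ofReal (Real.exp (w i * x - w i ^ 2 / 2))) := by
      intro i
      rw [← gaussianReal_eq_withDensity]
      infer_instance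
    rw [← pi_withDensity_eq _ (fun i x => ENNReal.ofReal (Real.exp (w i * x - w i ^ 2 / 2)))
      (fun _ => by fun_prop)]
    simp_rw [← gaussianReal_eq_withDensity]
    have h := Measure.pi_map_pi (μ := fun _ : ι => gaussianReal 0 1)
      (f := fun i (x : ℝ) => x + w i) (fun _ => by fun_prop)
    rw [h]
    congr 1
    ext i
    rw [gaussianReal_map_add_const, zero_add]
  ext s hs
  rw [withDensity_apply _ hs, ← map_pi_eq_stdGaussian,
    Measure.map_map (by fun_prop) (by fun_prop), ← lintegral_indicator hs,
    lintegral_map (Measurable.indicator (by fun_prop) hs) (by fun_prop)]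
  have h2 : Measure.map ((fun g : EuclideanSpace ℝ ι => g + w) ∘ WithLp.toLp 2)
      (Measure.pi fun _ : ι => gaussianReal 0 1) s =
      ((Measure.pi fun _ : ι => gaussianReal 0 1).map (fun x i => x i + w i))
        (WithLp.toLp 2 ⁻¹' s) := by
    rw [Measure.map_apply (by fun_prop) hs, Measure.map_apply (by fun_prop)
      ((by fun_prop : Measurable (WithLp.toLp 2 : (ι → ℝ) → EuclideanSpace ℝ ι)) hs)]
    rfl
  have hs' : MeasurableSet ((WithLp.toLp 2 : (ι → ℝ) → EuclideanSpace ℝ ι) ⁻¹' s) :=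
    (by fun_prop : Measurable (WithLp.toLp 2 : (ι → ℝ) → EuclideanSpace ℝ ι)) hs
  rw [h2, hpi, withDensity_apply _ hs', ← lintegral_indicator hs']
  congr 1
  ext x
  by_cases hx : WithLp.toLp 2 x ∈ s
  · rw [Set.indicator_of_mem (by exact hx), Set.indicator_of_mem hx,
      ← ENNReal.ofReal_prod_of_nonneg (fun _ _ => (Real.exp_pos _).le), ← Real.exp_sum]
    congr 2
    rw [Finset.sum_sub_distrib, EuclideanSpace.real_norm_sq_eq, Finset.sum_div]
    simp [PiLp.inner_apply, mul_comm]
  · rw [Set.indicator_of_notMem (by exact hx), Set.indicator_of_notMem hx]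

/-- The Gaussian mechanism: translating a standard Gaussian vector by a vector of norm at most
`ρ = ε / √(8 ℓ)` is an `(ε, exp (-ℓ))`-indistinguishable change. This is stated for test functions
with values in `[0, 1]` in place of events, which is the form that composes. -/
theorem lintegral_stdGaussian_translate_le {ι : Type*} [Fintype ι] (w : EuclideanSpace ℝ ι)
    {ε ℓ ρ : ℝ} (hε : 0 < ε) (hε1 : ε < 1) (hℓ : 1 ≤ ℓ) (hρ : 0 < ρ)
    (hρε : ρ ^ 2 * (8 * ℓ) = ε ^ 2) (hw : ‖w‖ ≤ ρ) {f : EuclideanSpace ℝ ι → ℝ≥0∞}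
    (hf : Measurable f) (hf1 : ∀ g, f g ≤ 1) :
    ∫⁻ g, f (g + w) ∂(stdGaussian (EuclideanSpace ℝ ι)) ≤
      ENNReal.ofReal (Real.exp ε) * ∫⁻ g, f g ∂(stdGaussian (EuclideanSpace ℝ ι)) +
        ENNReal.ofReal (Real.exp (-ℓ)) := by
  set γ := stdGaussian (EuclideanSpace ℝ ι)
  have h0 : ∫⁻ g, f (g + w) ∂γ =
      ∫⁻ g, ENNReal.ofReal (Real.exp (⟪w, g⟫ - ‖w‖ ^ 2 / 2)) * f g ∂γ := by
    rw [← lintegral_map hf (by fun_prop), stdGaussian_map_add_right,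
      lintegral_withDensity_eq_lintegral_mul _ (by fun_prop) hf]
    rfl
  -- `a` optimizes the exponential moment that bounds the part where the density exceeds `exp ε`
  set a : ℝ := ε / (2 * ρ ^ 2) with ha
  have ha0 : 0 < a := by positivity
  have hpt : ∀ g : EuclideanSpace ℝ ι, ENNReal.ofReal (Real.exp (⟪w, g⟫ - ‖w‖ ^ 2 / 2)) * f g ≤
      ENNReal.ofReal (Real.exp ε) * f g +
        ENNReal.ofReal (Real.exp (-((1 + a) * ‖w‖ ^ 2 / 2) - a * ε)) *
          ENNReal.ofReal (Real.exp ⟪(1 + a) • w, g⟫) := by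
    intro g
    rw [← ENNReal.ofReal_mul (Real.exp_pos _).le, ← Real.exp_add]
    rw [real_inner_smul_left]
    rcases le_total (⟪w, g⟫ - ‖w‖ ^ 2 / 2) ε with h | h
    · refine le_add_of_le_of_nonneg ?_ zero_le
      gcongr
    · refine le_add_of_nonneg_of_le zero_le ?_
      refine (mul_le_of_le_one_right' (hf1 g)).trans (ENNReal.ofReal_le_ofReal ?_)
      refine Real.exp_le_exp.2 ?_
      nlinarith [mul_le_mul_of_nonneg_left h ha0.le]
  rw [h0]
  refine (lintegral_mono hpt).trans ?_
  rw [lintegral_add_left (by fun_prop), lintegral_const_mul _ hf]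
  gcongr
  rw [lintegral_const_mul _ (by fun_prop), lintegral_exp_inner_stdGaussian,
    ← ENNReal.ofReal_mul (Real.exp_pos _).le, ← Real.exp_add]
  apply ENNReal.ofReal_le_ofReal
  apply Real.exp_le_exp.2
  rw [norm_smul, Real.norm_of_nonneg (by linarith)]
  have h1 : ‖w‖ ^ 2 ≤ ρ ^ 2 := by gcongr
  have h2 : a * ρ ^ 2 = ε / 2 := by
    rw [ha]; field_simp
  have h3 : a * ε = 4 * ℓ := by
    rw [ha]
    field_simp
    nlinarith
  have h4 : a * (1 + a) * ‖w‖ ^ 2 ≤ a * (1 + a) * ρ ^ 2 := by gcongr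
  nlinarith

end Gaussian

/-! ### The Frobenius norm -/

section FrobeniusNorm

variable {a b c : ℕ}

theorem frobNorm_nonneg (A : Matrix (Fin a) (Fin b) ℝ) : 0 ≤ frobNorm A := Real.sqrt_nonneg _

theorem frobNorm_sq (A : Matrix (Fin a) (Fin b) ℝ) : frobNorm A ^ 2 = ∑ i, ∑ j, A i j ^ 2 :=
  Real.sq_sqrt (Finset.sum_nonneg fun _ _ => Finset.sum_nonneg fun _ _ => sq_nonneg _)

theorem frobNorm_eq_norm (A : Matrix (Fin a) (Fin b) ℝ) :
    frobNorm A =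
      ‖(WithLp.toLp 2 fun q : Fin a × Fin b => A q.1 q.2 : EuclideanSpace ℝ (Fin a × Fin b))‖ := by
  rw [EuclideanSpace.norm_eq, frobNorm, Fintype.sum_prod_type]
  simp

theorem frobNorm_add_le (A B : Matrix (Fin a) (Fin b) ℝ) :
    frobNorm (A + B) ≤ frobNorm A + frobNorm B := by
  simp only [frobNorm_eq_norm]
  exact norm_add_le (WithLp.toLp 2 fun q : Fin a × Fin b => A q.1 q.2 :
    EuclideanSpace ℝ (Fin a × Fin b)) (WithLp.toLp 2 fun q : Fin a × Fin b => B q.1 q.2)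

theorem frobNorm_smul (t : ℝ) (A : Matrix (Fin a) (Fin b) ℝ) :
    frobNorm (t • A) = |t| * frobNorm A := by
  simp only [frobNorm_eq_norm]
  exact norm_smul t (WithLp.toLp 2 fun q : Fin a × Fin b => A q.1 q.2 :
    EuclideanSpace ℝ (Fin a × Fin b))

theorem frobNorm_neg (A : Matrix (Fin a) (Fin b) ℝ) : frobNorm (-A) = frobNorm A := by
  simp [frobNorm]

theorem frobNorm_sub_comm (A B : Matrix (Fin a) (Fin b) ℝ) :
    frobNorm (A - B) = frobNorm (B - A) := by
  rw [← frobNorm_neg, neg_sub]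

theorem frobNorm_sub_le (A B : Matrix (Fin a) (Fin b) ℝ) :
    frobNorm (A - B) ≤ frobNorm A + frobNorm B := by
  rw [sub_eq_add_neg, ← frobNorm_neg B]
  exact frobNorm_add_le _ _

theorem sum_mulVec_sq_le (A : Matrix (Fin a) (Fin b) ℝ) (x : Fin b → ℝ) :
    ∑ i, (A.mulVec x) i ^ 2 ≤ frobNorm A ^ 2 * ∑ j, x j ^ 2 := by
  rw [frobNorm_sq, Finset.sum_mul]
  exact Finset.sum_le_sum fun i _ => Finset.sum_mul_sq_le_sq_mul_sq Finset.univ (A i) x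

end FrobeniusNorm

/-! ### Measurability of matrix operations -/

section MatrixMeasurability

variable {α : Type*} [MeasurableSpace α] {a b c : ℕ}

theorem measurable_matrix_iff {f : α → Matrix (Fin a) (Fin b) ℝ} :
    Measurable f ↔ ∀ i j, Measurable fun x => f x i j :=
  measurable_pi_iff.trans (forall_congr' fun _ => measurable_pi_iff)

theorem measurable_entry {f : α → Matrix (Fin a) (Fin b) ℝ} (hf : Measurable f) (i : Fin a)
    (j : Fin b) : Measurable fun x => f x i j := measurable_matrix_iff.1 hf i j

theorem measurable_matrix_mul {f : α → Matrix (Fin a) (Fin b) ℝ}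
    {g : α → Matrix (Fin b) (Fin c) ℝ} (hf : Measurable f) (hg : Measurable g) :
    Measurable fun x => f x * g x :=
  measurable_matrix_iff.2 fun i j => by
    simp only [Matrix.mul_apply]
    exact Finset.measurable_fun_sum _ fun k _ =>
      (measurable_entry hf i k).mul (measurable_entry hg k j)

theorem measurable_matrix_add {f g : α → Matrix (Fin a) (Fin b) ℝ} (hf : Measurable f)
    (hg : Measurable g) : Measurable fun x => f x + g x :=
  measurable_matrix_iff.2 fun i j => (measurable_entry hf i j).add (measurable_entry hg i j)

theorem measurable_matrix_sub {f g : α → Matrix (Fin a) (Fin b) ℝ} (hf : Measurable f)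
    (hg : Measurable g) : Measurable fun x => f x - g x :=
  measurable_matrix_iff.2 fun i j => (measurable_entry hf i j).sub (measurable_entry hg i j)

theorem measurable_matrix_smul {t : α → ℝ} {f : α → Matrix (Fin a) (Fin b) ℝ} (ht : Measurable t)
    (hf : Measurable f) : Measurable fun x => t x • f x :=
  measurable_matrix_iff.2 fun i j => ht.mul (measurable_entry hf i j)

theorem measurable_matrix_transpose {f : α → Matrix (Fin a) (Fin b) ℝ} (hf : Measurable f) :
    Measurable fun x => (f x).transpose :=
  measurable_matrix_iff.2 fun i j => measurable_entry hf j i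

theorem measurable_frobNorm {f : α → Matrix (Fin a) (Fin b) ℝ} (hf : Measurable f) :
    Measurable fun x => frobNorm (f x) :=
  (Finset.measurable_fun_sum _ fun i _ => Finset.measurable_fun_sum _ fun j _ =>
    (measurable_entry hf i j).pow_const 2).sqrt

theorem measurable_matrix_inv {f : α → Matrix (Fin a) (Fin a) ℝ} (hf : Measurable f) :
    Measurable fun x => (f x)⁻¹ := by
  have hdet : ∀ {g : α → Matrix (Fin a) (Fin a) ℝ}, Measurable g →
      Measurable fun x => (g x).det := by
    intro g hg
    simp_rw [Matrix.det_apply']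
    exact Finset.measurable_sum _ fun σ _ => (Finset.measurable_prod _ fun i _ =>
      measurable_entry hg (σ i) i).const_mul _
  simp_rw [Matrix.inv_def, Ring.inverse_eq_inv']
  refine measurable_matrix_smul (hdet hf).inv (measurable_matrix_iff.2 fun i j => ?_)
  simp_rw [Matrix.adjugate_apply]
  refine hdet (measurable_matrix_iff.2 fun i' j' => ?_)
  simp_rw [Matrix.updateRow_apply]
  split_ifs
  · exact measurable_const
  · exact measurable_entry hf i' j'

end MatrixMeasurability

/-! ### Gaussian matrices -/

section GaussianMatrix

/-- The matrix with the entries of a Euclidean vector indexed by pairs. -/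
def matrixOfVec {a b : ℕ} (g : EuclideanSpace ℝ (Fin a × Fin b)) : Matrix (Fin a) (Fin b) ℝ :=
  Matrix.of fun i j => g (i, j)

/-- The law of an `a × b` matrix with independent standard Gaussian entries. -/
noncomputable def gaussianMatrix (a b : ℕ) : Measure (Matrix (Fin a) (Fin b) ℝ) :=
  (stdGaussian (EuclideanSpace ℝ (Fin a × Fin b))).map matrixOfVec

variable {a b c d q : ℕ}

theorem measurable_matrixOfVec :
    Measurable (matrixOfVec : EuclideanSpace ℝ (Fin a × Fin b) → Matrix (Fin a) (Fin b) ℝ) :=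
  measurable_matrix_iff.2 fun i j => by
    change Measurable fun x : EuclideanSpace ℝ (Fin a × Fin b) => x (i, j)
    fun_prop

instance isProbabilityMeasure_gaussianMatrix : IsProbabilityMeasure (gaussianMatrix a b) :=
  Measure.isProbabilityMeasure_map measurable_matrixOfVec.aemeasurable

/-- Orthonormal Frobenius functionals of a Gaussian matrix, arranged as a matrix, again form a
Gaussian matrix. -/
theorem gaussianMatrix_map {L : Matrix (Fin a) (Fin b) ℝ → Matrix (Fin c) (Fin d) ℝ}
    (hL : Measurable L) (e : Fin c × Fin d → EuclideanSpace ℝ (Fin a × Fin b))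
    (he : Orthonormal ℝ e) (hLe : ∀ g i j, L (matrixOfVec g) i j = ⟪e (i, j), g⟫) :
    (gaussianMatrix a b).map L = gaussianMatrix c d := by
  rw [gaussianMatrix, gaussianMatrix, ← stdGaussian_map_inner_orthonormal he,
    Measure.map_map hL measurable_matrixOfVec, Measure.map_map measurable_matrixOfVec
      (Continuous.measurable (by fun_prop))]
  congr 1
  ext g i j
  exact hLe g i j

theorem gaussianMatrix_map_transpose :
    (gaussianMatrix a b).map Matrix.transpose = gaussianMatrix b a := by
  refine gaussianMatrix_map (measurable_matrix_transpose measurable_id)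
    (fun k => EuclideanSpace.single (k.2, k.1) 1) ?_ ?_
  · rw [orthonormal_iff_ite]
    rintro ⟨i, j⟩ ⟨i', j'⟩
    simp [EuclideanSpace.inner_single_left, and_comm, Prod.ext_iff]
  · intro g i j
    simp [EuclideanSpace.inner_single_left, matrixOfVec]

theorem gaussianMatrix_map_transpose_mul {U : Matrix (Fin a) (Fin q) ℝ}
    (hU : U.transpose * U = 1) :
    (gaussianMatrix a b).map (fun N => U.transpose * N) = gaussianMatrix q b := by
  refine gaussianMatrix_map (measurable_matrix_mul measurable_const measurable_id)
    (fun k => WithLp.toLp 2 fun s => U s.1 k.1 * if s.2 = k.2 then 1 else 0) ?_ ?_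
  · rw [orthonormal_iff_ite]
    rintro ⟨i, j⟩ ⟨i', j'⟩
    have h := congrFun (congrFun hU i) i'
    simp only [Matrix.mul_apply, Matrix.transpose_apply, Matrix.one_apply] at h
    by_cases hj : j = j'
    · subst hj
      simp [PiLp.inner_apply, Fintype.sum_prod_type, ← h, mul_comm]
    · simp [PiLp.inner_apply, Fintype.sum_prod_type, hj]
  · intro g i j
    simp [PiLp.inner_apply, Fintype.sum_prod_type, matrixOfVec, Matrix.mul_apply, mul_comm]

theorem lintegral_gaussianMatrix {f : Matrix (Fin a) (Fin b) ℝ → ℝ≥0∞} (hf : Measurable f) :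
    ∫⁻ N, f N ∂(gaussianMatrix a b) =
      ∫⁻ g, f (matrixOfVec g) ∂(stdGaussian (EuclideanSpace ℝ (Fin a × Fin b))) :=
  lintegral_map hf measurable_matrixOfVec

/-- The second moment `E ‖Z N‖² = b ‖Z‖²` for a Gaussian matrix `N` with `b` columns. -/
theorem lintegral_frobNorm_mul_sq (Z : Matrix (Fin q) (Fin a) ℝ) :
    ∫⁻ N, ENNReal.ofReal (frobNorm (Z * N) ^ 2) ∂(gaussianMatrix a b) =
      ENNReal.ofReal (b * frobNorm Z ^ 2) := by
  rw [lintegral_gaussianMatrix (f := fun N => ENNReal.ofReal (frobNorm (Z * N) ^ 2))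
    ((measurable_frobNorm (measurable_matrix_mul measurable_const
      measurable_id)).pow_const 2).ennreal_ofReal]
  have h : ∀ g : EuclideanSpace ℝ (Fin a × Fin b),
      ENNReal.ofReal (frobNorm (Z * matrixOfVec g) ^ 2) =
      ∑ i, ∑ j, ENNReal.ofReal (⟪(WithLp.toLp 2 fun s => Z i s.1 * if s.2 = j then 1 else 0 :
        EuclideanSpace ℝ (Fin a × Fin b)), g⟫ ^ 2) := by
    intro g
    rw [frobNorm_sq]
    refine (ENNReal.ofReal_sum_of_nonneg
      (fun _ _ => Finset.sum_nonneg fun _ _ => sq_nonneg _)).trans ?_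
    refine Finset.sum_congr rfl fun i _ => ?_
    refine (ENNReal.ofReal_sum_of_nonneg (fun _ _ => sq_nonneg _)).trans ?_
    refine Finset.sum_congr rfl fun j _ => ?_
    simp [PiLp.inner_apply, Fintype.sum_prod_type, matrixOfVec, Matrix.mul_apply, mul_comm]
  simp_rw [h]
  rw [lintegral_finsetSum _ (fun i _ => by fun_prop)]
  have h2 : ∀ i : Fin q, ∫⁻ g : EuclideanSpace ℝ (Fin a × Fin b),
      ∑ j, ENNReal.ofReal (⟪(WithLp.toLp 2 fun s => Z i s.1 * if s.2 = j then 1 else 0 :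
        EuclideanSpace ℝ (Fin a × Fin b)), g⟫ ^ 2) ∂(stdGaussian _) =
      ENNReal.ofReal (b * ∑ s, Z i s ^ 2) := by
    intro i
    rw [lintegral_finsetSum _ (fun i _ => by fun_prop)]
    simp_rw [lintegral_inner_sq_stdGaussian, EuclideanSpace.real_norm_sq_eq,
      Fintype.sum_prod_type]
    rw [← ENNReal.ofReal_sum_of_nonneg (fun _ _ => Finset.sum_nonneg fun _ _ =>
      Finset.sum_nonneg fun _ _ => sq_nonneg _)]
    simp
  simp_rw [h2]
  rw [← ENNReal.ofReal_sum_of_nonneg (fun _ _ => by positivity), ← Finset.mul_sum, frobNorm_sq]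

/-- Markov's inequality. -/
theorem measure_lt_of_lintegral_le {α : Type*} [MeasurableSpace α] {μ : Measure α} {f : α → ℝ}
    (hf : Measurable f) {M : ℝ} (hM : 0 ≤ M)
    (h : ∫⁻ x, ENNReal.ofReal (f x) ∂μ ≤ ENNReal.ofReal M) :
    μ {x | 100 * M < f x} ≤ ENNReal.ofReal (1 / 100) := by
  rcases hM.eq_or_lt with rfl | hM
  · have h0 : ∫⁻ x, ENNReal.ofReal (f x) ∂μ = 0 := by simpa using h
    rw [lintegral_eq_zero_iff (by fun_prop)] at h0
    have : μ {x | 100 * 0 < f x} = 0 := by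
      refine measure_mono_null ?_ (ae_iff.1 h0)
      intro x hx
      simpa using hx
    rw [this]
    exact zero_le
  · have h1 := mul_meas_ge_le_lintegral (μ := μ) (f := fun x => ENNReal.ofReal (f x))
      (by fun_prop) (ENNReal.ofReal (100 * M))
    have h2 : ENNReal.ofReal (100 * M) * μ {x | 100 * M < f x} ≤ ENNReal.ofReal M := by
      refine le_trans ?_ (h1.trans h)
      gcongr with x
      intro hx
      exact ENNReal.ofReal_le_ofReal (le_of_lt hx)
    have h3 : μ {x | 100 * M < f x} ≤ ENNReal.ofReal M / ENNReal.ofReal (100 * M) := by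
      rw [ENNReal.le_div_iff_mul_le (by simp [hM]) (by simp), mul_comm]
      exact h2
    refine h3.trans_eq ?_
    rw [← ENNReal.ofReal_div_of_pos (by positivity)]
    congr 1
    field_simp

theorem gaussianMatrix_frobNorm_mul_tail (Z : Matrix (Fin q) (Fin a) ℝ) :
    gaussianMatrix a b {N | 100 * (b * frobNorm Z ^ 2) < frobNorm (Z * N) ^ 2} ≤
      ENNReal.ofReal (1 / 100) :=
  measure_lt_of_lintegral_le ((measurable_frobNorm (measurable_matrix_mul measurable_const
    measurable_id)).pow_const 2) (by positivity) (lintegral_frobNorm_mul_sq Z).le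

theorem gaussianMatrix_frobNorm_tail :
    gaussianMatrix a b {N | 100 * ((a : ℝ) * b) < frobNorm N ^ 2} ≤ ENNReal.ofReal (1 / 100) := by
  have h := gaussianMatrix_frobNorm_mul_tail (b := b) (1 : Matrix (Fin a) (Fin a) ℝ)
  have h1 : frobNorm (1 : Matrix (Fin a) (Fin a) ℝ) ^ 2 = a := by
    rw [frobNorm_sq]
    simp [Matrix.one_apply]
  simp only [h1, Matrix.one_mul] at h
  simpa only [mul_comm (a : ℝ)] using h

/-- A Chernoff bound. -/
theorem measure_le_of_lintegral_exp_le {α : Type*} [MeasurableSpace α] {μ : Measure α} {f : α → ℝ}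
    (hf : Measurable f) {s t : ℝ}
    (h : ∫⁻ x, ENNReal.ofReal (Real.exp (f x)) ∂μ ≤ ENNReal.ofReal (Real.exp (s + t))) :
    μ {x | s ≤ f x} ≤ ENNReal.ofReal (Real.exp t) := by
  have h1 := mul_meas_ge_le_lintegral (μ := μ) (f := fun x => ENNReal.ofReal (Real.exp (f x)))
    (by fun_prop) (ENNReal.ofReal (Real.exp s))
  have h2 : ENNReal.ofReal (Real.exp s) * μ {x | s ≤ f x} ≤
      ENNReal.ofReal (Real.exp s) * ENNReal.ofReal (Real.exp t) := by
    rw [← ENNReal.ofReal_mul (Real.exp_pos _).le, ← Real.exp_add]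
    refine le_trans ?_ (h1.trans h)
    gcongr with x
    intro hx
    exact ENNReal.ofReal_le_ofReal (Real.exp_le_exp.2 hx)
  exact (ENNReal.mul_le_mul_iff_right (by simp [Real.exp_pos]) (by simp)).1 h2

/-- Upper tail of a chi-square variable with `b` degrees of freedom. -/
theorem gaussianMatrix_sum_vecMul_sq_tail {v : Fin a → ℝ} (hv : ∑ i, v i ^ 2 ≤ 1) (x : ℝ) :
    gaussianMatrix a b {N | 4 * (b + x) ≤ ∑ j, (Matrix.vecMul v N) j ^ 2} ≤
      ENNReal.ofReal (Real.exp (-x)) := by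
  set c : ℝ := ∑ i, v i ^ 2 with hc
  have hc0 : 0 ≤ c := Finset.sum_nonneg fun _ _ => sq_nonneg _
  rcases hc0.eq_or_lt with h0 | hpos
  · have hv0 : v = 0 := by
      ext i
      have := (Finset.sum_eq_zero_iff_of_nonneg (fun i _ => sq_nonneg (v i))).1 h0.symm i
        (Finset.mem_univ i)
      simpa using this
    subst hv0
    rcases lt_or_ge 0 x with hx | hx
    · have : {N : Matrix (Fin a) (Fin b) ℝ |
          4 * (b + x) ≤ ∑ j, (Matrix.vecMul 0 N) j ^ 2} = ∅ := by
        ext N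
        simp only [Matrix.zero_vecMul, Pi.zero_apply, Set.mem_ofPred_eq, Set.mem_empty_iff_false,
          iff_false, not_le]
        have : (0 : ℝ) ≤ b := by positivity
        simp
        linarith
      rw [this]
      simp
    · refine prob_le_one.trans ?_
      rw [ENNReal.one_le_ofReal]
      exact Real.one_le_exp (by linarith)
  set e : Fin b → EuclideanSpace ℝ (Fin a × Fin b) := fun j =>
    WithLp.toLp 2 fun s => v s.1 / √c * if s.2 = j then 1 else 0 with he_def
  have he : Orthonormal ℝ e := by
    rw [orthonormal_iff_ite]
    intro j j'
    by_cases hj : j = j'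
    · subst hj
      simp only [he_def, PiLp.inner_apply, Fintype.sum_prod_type]
      simp only [mul_ite, mul_one, mul_zero, RCLike.inner_apply, conj_trivial, ite_mul, zero_mul,
        Finset.sum_ite_eq', Finset.mem_univ, if_true]
      simp_rw [div_mul_div_comm, Real.mul_self_sqrt hc0, ← pow_two, ← Finset.sum_div, ← hc]
      exact div_self hpos.ne'
    · simp [he_def, PiLp.inner_apply, Fintype.sum_prod_type, hj]
  have hsum : ∀ g : EuclideanSpace ℝ (Fin a × Fin b),
      ∑ j, (Matrix.vecMul v (matrixOfVec g)) j ^ 2 = c * ∑ j, ⟪e j, g⟫ ^ 2 := by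
    intro g
    rw [Finset.mul_sum]
    refine Finset.sum_congr rfl fun j _ => ?_
    have : ⟪e j, g⟫ = (Matrix.vecMul v (matrixOfVec g)) j / √c := by
      simp only [he_def, PiLp.inner_apply, Fintype.sum_prod_type, Matrix.vecMul, dotProduct,
        matrixOfVec, Finset.sum_div]
      refine Finset.sum_congr rfl fun i _ => ?_
      simp
      ring
    rw [this, div_pow, Real.sq_sqrt hc0]
    field_simp
  have hmeas : MeasurableSet {N : Matrix (Fin a) (Fin b) ℝ |
      4 * (b + x) ≤ ∑ j, (Matrix.vecMul v N) j ^ 2} := by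
    refine measurableSet_le measurable_const (Finset.measurable_fun_sum _ fun j _ => ?_)
    simp only [Matrix.vecMul, dotProduct]
    exact (Finset.measurable_fun_sum _ fun i _ =>
      (measurable_entry measurable_id i j).const_mul _).pow_const 2
  rw [gaussianMatrix, Measure.map_apply measurable_matrixOfVec hmeas]
  refine (measure_mono ?_).trans (measure_le_of_lintegral_exp_le
    (f := fun g => 1 / 4 * ∑ j, ⟪e j, g⟫ ^ 2) (s := b + x) (t := -x) (by fun_prop) ?_)
  · intro g hg
    simp only [Set.mem_preimage, Set.mem_ofPred_eq, hsum] at hg ⊢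
    have : 0 ≤ ∑ j, ⟪e j, g⟫ ^ 2 := Finset.sum_nonneg fun _ _ => sq_nonneg _
    nlinarith
  · rw [lintegral_exp_sum_inner_sq he (by norm_num), ← ENNReal.ofReal_pow (Real.sqrt_nonneg _),
      Fintype.card_fin]
    apply ENNReal.ofReal_le_ofReal
    have h1 : (b : ℝ) + x + -x = b * 1 := by ring
    rw [h1, Real.exp_nat_mul]
    gcongr
    rw [Real.sqrt_le_left (Real.exp_pos _).le]
    nlinarith [Real.add_one_le_exp 1]

/-- Lower tail of a chi-square variable with `a` degrees of freedom. -/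
theorem gaussianMatrix_sum_mulVec_sq_tail {x : Fin b → ℝ} (hx : 0 < ∑ i, x i ^ 2) :
    gaussianMatrix a b {N | ∑ i, (N.mulVec x) i ^ 2 ≤ a / 4 * ∑ j, x j ^ 2} ≤
      ENNReal.ofReal (Real.exp (-(a / 4))) := by
  set c : ℝ := ∑ i, x i ^ 2 with hc
  have hc0 : 0 ≤ c := hx.le
  set e : Fin a → EuclideanSpace ℝ (Fin a × Fin b) := fun i =>
    WithLp.toLp 2 fun s => (if s.1 = i then 1 else 0) * (x s.2 / √c) with he_def
  have he : Orthonormal ℝ e := by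
    rw [orthonormal_iff_ite]
    intro j j'
    by_cases hj : j = j'
    · subst hj
      simp only [he_def, PiLp.inner_apply, Fintype.sum_prod_type_right]
      simp only [mul_ite, one_mul, mul_zero, RCLike.inner_apply, conj_trivial, ite_mul, zero_mul,
        Finset.sum_ite_eq', Finset.mem_univ, if_true]
      simp_rw [div_mul_div_comm, Real.mul_self_sqrt hc0, ← pow_two, ← Finset.sum_div, ← hc]
      exact div_self hx.ne'
    · simp [he_def, PiLp.inner_apply, Fintype.sum_prod_type_right, hj]
  have hsum : ∀ g : EuclideanSpace ℝ (Fin a × Fin b),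
      ∑ i, ((matrixOfVec g).mulVec x) i ^ 2 = c * ∑ i, ⟪e i, g⟫ ^ 2 := by
    intro g
    rw [Finset.mul_sum]
    refine Finset.sum_congr rfl fun j _ => ?_
    have : ⟪e j, g⟫ = ((matrixOfVec g).mulVec x) j / √c := by
      simp only [he_def, PiLp.inner_apply, Fintype.sum_prod_type_right, Matrix.mulVec, dotProduct,
        matrixOfVec, Finset.sum_div]
      refine Finset.sum_congr rfl fun i _ => ?_
      simp
      ring
    rw [this, div_pow, Real.sq_sqrt hc0]
    field_simp
  have hmeas : MeasurableSet {N : Matrix (Fin a) (Fin b) ℝ |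
      ∑ i, (N.mulVec x) i ^ 2 ≤ a / 4 * c} := by
    refine measurableSet_le (Finset.measurable_fun_sum _ fun j _ => ?_) measurable_const
    simp only [Matrix.mulVec, dotProduct]
    exact (Finset.measurable_fun_sum _ fun i _ =>
      (measurable_entry measurable_id j i).mul_const _).pow_const 2
  rw [gaussianMatrix, Measure.map_apply measurable_matrixOfVec hmeas]
  refine (measure_mono ?_).trans (measure_le_of_lintegral_exp_le
    (f := fun g => -1 * ∑ j, ⟪e j, g⟫ ^ 2) (s := -(a / 4)) (t := -(a / 4)) (by fun_prop) ?_)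
  · intro g hg
    simp only [Set.mem_preimage, Set.mem_ofPred_eq, hsum] at hg ⊢
    have : ∑ j, ⟪e j, g⟫ ^ 2 ≤ a / 4 := le_of_mul_le_mul_left (by linarith) hx
    linarith
  · rw [lintegral_exp_sum_inner_sq he (by norm_num), ← ENNReal.ofReal_pow (Real.sqrt_nonneg _),
      Fintype.card_fin]
    apply ENNReal.ofReal_le_ofReal
    have h1 : -((a : ℝ) / 4) + -(a / 4) = a * (-(1 / 2)) := by ring
    rw [h1, Real.exp_nat_mul]
    gcongr
    rw [Real.sqrt_le_left (Real.exp_pos _).le, ← Real.exp_nat_mul]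
    norm_num
    rw [Real.exp_neg, one_div, inv_le_inv₀ (by norm_num) (Real.exp_pos _)]
    exact Real.exp_one_lt_three.le

end GaussianMatrix

/-! ### The smallest singular value of a Gaussian matrix -/

section SmallestSingularValue

variable {d q : ℕ}

/-- A matrix of moderate Frobenius norm that does not contract the nonzero points of the integer
grid `[-80 d, 80 d] ^ d` much is bounded below everywhere. -/
theorem sum_mulVec_sq_ge_of_grid (G : Matrix (Fin q) (Fin d) ℝ)
    (hG : frobNorm G ^ 2 ≤ 100 * ((q : ℝ) * d))
    (hgrid : ∀ z ∈ Fintype.piFinset fun _ : Fin d => Finset.Icc (-(80 * d : ℤ)) (80 * d), z ≠ 0 →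
      (q : ℝ) / 4 * ∑ j, (z j : ℝ) ^ 2 < ∑ i, (G.mulVec fun j => (z j : ℝ)) i ^ 2)
    (x : Fin d → ℝ) : (q : ℝ) / 64 * ∑ j, x j ^ 2 ≤ ∑ i, (G.mulVec x) i ^ 2 := by
  rcases Nat.eq_zero_or_pos d with rfl | hd
  · simp only [Finset.univ_eq_empty, Finset.sum_empty, mul_zero]
    exact Finset.sum_nonneg fun _ _ => sq_nonneg _
  have hd1 : (1 : ℝ) ≤ d := by exact_mod_cast hd
  -- rephrase everything with Euclidean norms
  let T : EuclideanSpace ℝ (Fin d) →ₗ[ℝ] EuclideanSpace ℝ (Fin q) := Matrix.toEuclideanLin G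
  have hT : ∀ y, ‖T y‖ ^ 2 = ∑ i, (G.mulVec y.ofLp) i ^ 2 := fun y => by
    rw [EuclideanSpace.real_norm_sq_eq]; rfl
  have hTle : ∀ y, ‖T y‖ ≤ frobNorm G * ‖y‖ := fun y => by
    refine (sq_le_sq₀ (norm_nonneg _) (mul_nonneg (frobNorm_nonneg _) (norm_nonneg _))).1 ?_
    rw [hT, mul_pow, EuclideanSpace.real_norm_sq_eq]
    exact sum_mulVec_sq_le G y.ofLp
  have hF : frobNorm G ≤ 10 * √q * √d := by
    refine (sq_le_sq₀ (frobNorm_nonneg _) (by positivity)).1 ?_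
    rw [mul_pow, mul_pow, Real.sq_sqrt (by positivity), Real.sq_sqrt (by positivity)]
    linarith
  have hunit : ∀ y : EuclideanSpace ℝ (Fin d), ‖y‖ = 1 → √q / 8 ≤ ‖T y‖ := by
    intro y hy
    have hyj : ∀ j, |y j| ≤ 1 := fun j => by
      have := PiLp.norm_apply_le y j
      rwa [hy, Real.norm_eq_abs] at this
    let z : Fin d → ℤ := fun j => ⌊80 * (d : ℝ) * y j⌋
    let zr : EuclideanSpace ℝ (Fin d) := WithLp.toLp 2 fun j => (z j : ℝ)
    have hz : z ∈ Fintype.piFinset fun _ : Fin d => Finset.Icc (-(80 * d : ℤ)) (80 * d) := by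
      rw [Fintype.mem_piFinset]
      intro j
      have h := abs_le.1 (hyj j)
      rw [Finset.mem_Icc]
      constructor
      · rw [Int.le_floor]
        push_cast
        nlinarith
      · have h2 : ((z j : ℤ) : ℝ) ≤ ((80 * d : ℤ) : ℝ) := by
          refine (Int.floor_le _).trans ?_
          push_cast
          nlinarith
        exact_mod_cast h2
    have hdiff : ‖(80 * (d : ℝ)) • y - zr‖ ≤ √d := by
      apply Real.le_sqrt_of_sq_le
      rw [EuclideanSpace.real_norm_sq_eq]
      calc ∑ j, ((80 * (d : ℝ)) • y - zr) j ^ 2 ≤ ∑ _j : Fin d, (1 : ℝ) := by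
            refine Finset.sum_le_sum fun j _ => ?_
            have h1 := Int.fract_nonneg (80 * (d : ℝ) * y j)
            have h2 := (Int.fract_lt_one (80 * (d : ℝ) * y j)).le
            have h3 : ((80 * (d : ℝ)) • y - zr) j = Int.fract (80 * (d : ℝ) * y j) := rfl
            rw [h3]
            nlinarith
        _ = d := by simp
    have hsd : √(d : ℝ) ≤ d := by
      rw [Real.sqrt_le_left (by positivity)]
      nlinarith
    have hsm : ‖(80 * (d : ℝ)) • y‖ = 80 * d := by
      rw [norm_smul, hy, mul_one, Real.norm_of_nonneg (by positivity)]
    have hzr : 79 * (d : ℝ) ≤ ‖zr‖ := by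
      have := norm_sub_norm_le ((80 * (d : ℝ)) • y) zr
      linarith
    have hz0 : z ≠ 0 := by
      intro h
      have h0 : zr = 0 := by
        ext j
        simp [zr, h]
      rw [h0, norm_zero] at hzr
      linarith
    have h1 := hgrid z hz hz0
    have h2 : √q / 2 * ‖zr‖ ≤ ‖T zr‖ := by
      refine (sq_le_sq₀ (by positivity) (norm_nonneg _)).1 ?_
      rw [hT, mul_pow, div_pow, Real.sq_sqrt (by positivity), EuclideanSpace.real_norm_sq_eq]
      norm_num
      exact h1.le
    have h3 : ‖T ((80 * (d : ℝ)) • y - zr)‖ ≤ 10 * √q * √d * √d :=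
      (hTle _).trans (mul_le_mul hF hdiff (norm_nonneg _) (by positivity))
    rw [mul_assoc (10 * √q), Real.mul_self_sqrt (by positivity)] at h3
    have h4 : ‖T zr‖ ≤ ‖T ((80 * (d : ℝ)) • y)‖ + ‖T ((80 * (d : ℝ)) • y - zr)‖ := by
      have h5 : T zr = T ((80 * (d : ℝ)) • y) - T ((80 * (d : ℝ)) • y - zr) := by
        rw [← map_sub, sub_sub_cancel]
      rw [h5]
      exact norm_sub_le _ _
    rw [map_smul, norm_smul, Real.norm_of_nonneg (by positivity)] at h4
    have h6 : √q / 2 * (79 * d) ≤ √q / 2 * ‖zr‖ := by gcongr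
    have h7 : 0 ≤ √q * d := by positivity
    have h8 : 80 * (d : ℝ) * (√q / 8) ≤ 80 * d * ‖T y‖ := by linarith
    exact le_of_mul_le_mul_left h8 (by positivity)
  let y : EuclideanSpace ℝ (Fin d) := WithLp.toLp 2 x
  have hgoal : √q / 8 * ‖y‖ ≤ ‖T y‖ := by
    rcases eq_or_ne y 0 with h0 | h0
    · simp [h0]
    · have h1 := hunit (‖y‖⁻¹ • y) (by
        rw [norm_smul, norm_inv, norm_norm, inv_mul_cancel₀ (norm_ne_zero_iff.2 h0)])
      rw [map_smul, norm_smul, norm_inv, norm_norm] at h1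
      have h2 : 0 < ‖y‖ := norm_pos_iff.2 h0
      rw [inv_mul_eq_div, le_div_iff₀ h2] at h1
      exact h1
  have h9 := pow_le_pow_left₀ (by positivity) hgoal 2
  rw [hT, mul_pow, div_pow, Real.sq_sqrt (by positivity), EuclideanSpace.real_norm_sq_eq] at h9
  norm_num at h9
  exact h9

/-- A lower bound for the smallest singular value of a tall Gaussian matrix. -/
theorem gaussianMatrix_sum_mulVec_sq_ge
    (hq : 4 * ((d : ℝ) * Real.log (161 * d) + 5) ≤ q) :
    gaussianMatrix q d {G | ¬ ∀ x : Fin d → ℝ,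
      (q : ℝ) / 64 * ∑ j, x j ^ 2 ≤ ∑ i, (G.mulVec x) i ^ 2} ≤ ENNReal.ofReal (2 / 100) := by
  classical
  set grid := Fintype.piFinset fun _ : Fin d => Finset.Icc (-(80 * d : ℤ)) (80 * d)
  have hsub : {G : Matrix (Fin q) (Fin d) ℝ | ¬ ∀ x : Fin d → ℝ,
      (q : ℝ) / 64 * ∑ j, x j ^ 2 ≤ ∑ i, (G.mulVec x) i ^ 2} ⊆
      {G | 100 * ((q : ℝ) * d) < frobNorm G ^ 2} ∪
      ⋃ z ∈ grid.erase 0, {G | ∑ i, (G.mulVec fun j => (z j : ℝ)) i ^ 2 ≤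
        (q : ℝ) / 4 * ∑ j, (z j : ℝ) ^ 2} := by
    intro G hG
    by_contra hcon
    simp only [Set.mem_union, Set.mem_iUnion, not_or, not_exists, Set.mem_ofPred_eq, not_le,
      not_lt, Finset.mem_erase] at hcon
    exact hG (sum_mulVec_sq_ge_of_grid G hcon.1 fun z hz hz0 => hcon.2 z ⟨hz0, hz⟩)
  have hgridcard : (grid.erase 0).card ≤ (161 * d) ^ d := by
    rcases Nat.eq_zero_or_pos d with rfl | hd
    · exact (Finset.card_erase_le).trans (by simp [grid])
    refine (Finset.card_erase_le).trans ?_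
    rw [Fintype.card_piFinset]
    simp only [Int.card_Icc, Finset.prod_const, Finset.card_univ, Fintype.card_fin]
    gcongr
    omega
  refine (measure_mono hsub).trans ((measure_union_le _ _).trans ?_)
  have h1 : gaussianMatrix q d (⋃ z ∈ grid.erase 0, {G | ∑ i, (G.mulVec fun j => (z j : ℝ)) i ^ 2 ≤
        (q : ℝ) / 4 * ∑ j, (z j : ℝ) ^ 2}) ≤ ENNReal.ofReal (1 / 100) := by
    refine (measure_biUnion_finset_le _ _).trans ?_
    have h2 : ∀ z ∈ grid.erase 0, gaussianMatrix q d {G | ∑ i, (G.mulVec fun j => (z j : ℝ)) i ^ 2 ≤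
        (q : ℝ) / 4 * ∑ j, (z j : ℝ) ^ 2} ≤ ENNReal.ofReal (Real.exp (-(q / 4))) := by
      intro z hz
      apply gaussianMatrix_sum_mulVec_sq_tail
      have hz0 : z ≠ 0 := (Finset.mem_erase.1 hz).1
      obtain ⟨j, hj⟩ := Function.ne_iff.1 hz0
      refine Finset.sum_pos' (fun _ _ => sq_nonneg _) ⟨j, Finset.mem_univ j, ?_⟩
      have : (z j : ℝ) ≠ 0 := by exact_mod_cast hj
      positivity
    refine (Finset.sum_le_sum h2).trans ?_
    rw [Finset.sum_const, nsmul_eq_mul, ← ENNReal.ofReal_natCast, ← ENNReal.ofReal_mul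
      (by positivity)]
    apply ENNReal.ofReal_le_ofReal
    have h3 : ((grid.erase 0).card : ℝ) ≤ Real.exp (d * Real.log (161 * d)) := by
      rcases Nat.eq_zero_or_pos d with rfl | hd
      · simp only [CharP.cast_eq_zero, zero_mul, Real.exp_zero]
        exact_mod_cast hgridcard
      · rw [Real.exp_nat_mul, Real.exp_log (by positivity)]
        exact_mod_cast hgridcard
    calc ((grid.erase 0).card : ℝ) * Real.exp (-(q / 4))
        ≤ Real.exp (d * Real.log (161 * d)) * Real.exp (-(q / 4)) := by gcongr
      _ ≤ Real.exp (-5) := by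
          rw [← Real.exp_add]
          apply Real.exp_le_exp.2
          linarith
      _ ≤ 1 / 100 := by
          rw [Real.exp_neg, one_div]
          apply inv_anti₀ (by norm_num)
          have h5 : Real.exp 5 = Real.exp 1 ^ 5 := by rw [← Real.exp_nat_mul]; norm_num
          rw [h5]
          have h6 : (2.7 : ℝ) ≤ Real.exp 1 := (by norm_num : (2.7 : ℝ) ≤ 2.7182818283).trans
            Real.exp_one_gt_d9.le
          calc (100 : ℝ) ≤ 2.7 ^ 5 := by norm_num
            _ ≤ _ := by gcongr
  refine (add_le_add gaussianMatrix_frobNorm_tail h1).trans_eq ?_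
  rw [← ENNReal.ofReal_add (by norm_num) (by norm_num)]
  norm_num

end SmallestSingularValue

/-! ### The mechanism -/

section Mechanism

variable {m n l : ℕ}

/-- The orthogonal projection `Y (Yᵀ Y)⁻¹ Yᵀ` onto the column space of a matrix `Y` of full column
rank; it is `0` for all other matrices, the inverse being `0` then. -/
noncomputable def colProj (Y : Matrix (Fin m) (Fin l) ℝ) : Matrix (Fin m) (Fin m) ℝ :=
  Y * (Y.transpose * Y)⁻¹ * Y.transpose

/-- The largest norm of a column of `colProj Y`: the square root of the coherence of the column
space of `Y`, up to normalization. -/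
noncomputable def colProjWidth (Y : Matrix (Fin m) (Fin l) ℝ) : ℝ :=
  ⨆ i : Fin m, √(∑ j, colProj Y j i ^ 2)

theorem colProj_transpose (Y : Matrix (Fin m) (Fin l) ℝ) :
    (colProj Y).transpose = colProj Y := by
  simp [colProj, Matrix.transpose_mul, Matrix.transpose_nonsing_inv, Matrix.mul_assoc]

theorem colProj_mul_self (Y : Matrix (Fin m) (Fin l) ℝ) : colProj Y * colProj Y = colProj Y := by
  by_cases h : IsUnit (Y.transpose * Y).det
  · calc colProj Y * colProj Y
        = Y * (Y.transpose * Y)⁻¹ * ((Y.transpose * Y) * (Y.transpose * Y)⁻¹) * Y.transpose := by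
          simp only [colProj, Matrix.mul_assoc]
      _ = colProj Y := by rw [Matrix.mul_nonsing_inv _ h, Matrix.mul_one, colProj]
  · simp [colProj, Matrix.nonsing_inv_apply_not_isUnit _ h]

theorem colProj_mul (Y : Matrix (Fin m) (Fin l) ℝ) (h : IsUnit (Y.transpose * Y).det) :
    colProj Y * Y = Y := by
  rw [colProj, Matrix.mul_assoc, Matrix.mul_assoc, Matrix.nonsing_inv_mul _ h, Matrix.mul_one]

/-- The squared Frobenius norm of a projection is its rank. -/
theorem frobNorm_colProj_sq_le (Y : Matrix (Fin m) (Fin l) ℝ) : frobNorm (colProj Y) ^ 2 ≤ l := by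
  have h1 : frobNorm (colProj Y) ^ 2 = (colProj Y).trace := by
    nth_rw 2 [← colProj_mul_self Y]
    nth_rw 2 [← colProj_transpose Y]
    rw [frobNorm_sq, Finset.sum_comm]
    simp [Matrix.trace, Matrix.mul_apply, pow_two]
  rw [h1]
  by_cases h : IsUnit (Y.transpose * Y).det
  · rw [colProj, Matrix.mul_assoc, Matrix.trace_mul_comm, Matrix.mul_assoc,
      Matrix.nonsing_inv_mul _ h]
    simp
  · simp [colProj, Matrix.nonsing_inv_apply_not_isUnit _ h]

theorem sqrt_sum_colProj_sq_le (Y : Matrix (Fin m) (Fin l) ℝ) (i : Fin m) :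
    √(∑ j, colProj Y j i ^ 2) ≤ colProjWidth Y :=
  le_ciSup (f := fun i => √(∑ j, colProj Y j i ^ 2)) (Set.finite_range _).bddAbove i

theorem colProjWidth_nonneg (Y : Matrix (Fin m) (Fin l) ℝ) : 0 ≤ colProjWidth Y :=
  Real.iSup_nonneg fun _ => Real.sqrt_nonneg _

theorem measurable_colProj {α : Type*} [MeasurableSpace α] {f : α → Matrix (Fin m) (Fin l) ℝ}
    (hf : Measurable f) : Measurable fun x => colProj (f x) :=
  have ht := measurable_matrix_transpose hf
  measurable_matrix_mul (measurable_matrix_mul hf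
    (measurable_matrix_inv (measurable_matrix_mul ht hf))) ht

theorem measurable_colProjWidth {α : Type*} [MeasurableSpace α]
    {f : α → Matrix (Fin m) (Fin l) ℝ} (hf : Measurable f) :
    Measurable fun x => colProjWidth (f x) :=
  Measurable.iSup fun i => (Finset.measurable_fun_sum _ fun j _ =>
    (measurable_entry (measurable_colProj hf) j i).pow_const 2).sqrt

/-- The noisy sketch `A Ω + σ N` of `A`. -/
def sketch (σ : ℝ) (A : Matrix (Fin m) (Fin n) ℝ) (Ω : Matrix (Fin n) (Fin l) ℝ)
    (N : Matrix (Fin m) (Fin l) ℝ) : Matrix (Fin m) (Fin l) ℝ :=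
  A * Ω + σ • N

/-- The projection of a noisy version of `A` to the column space of `Y`. The noise is scaled by the
coherence of `Y`. -/
noncomputable def noisyProj (ρ : ℝ) (A : Matrix (Fin m) (Fin n) ℝ) (Y : Matrix (Fin m) (Fin l) ℝ)
    (N : Matrix (Fin m) (Fin n) ℝ) : Matrix (Fin m) (Fin n) ℝ :=
  colProj Y * (A + (colProjWidth Y / ρ) • N)

theorem measurable_sketch {α : Type*} [MeasurableSpace α] (σ : ℝ)
    {A : α → Matrix (Fin m) (Fin n) ℝ} {Ω : α → Matrix (Fin n) (Fin l) ℝ}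
    {N : α → Matrix (Fin m) (Fin l) ℝ} (hA : Measurable A) (hΩ : Measurable Ω)
    (hN : Measurable N) : Measurable fun x => sketch σ (A x) (Ω x) (N x) :=
  measurable_matrix_add (measurable_matrix_mul hA hΩ) (measurable_matrix_smul measurable_const hN)

theorem measurable_noisyProj {α : Type*} [MeasurableSpace α] (ρ : ℝ)
    {A : α → Matrix (Fin m) (Fin n) ℝ} {Y : α → Matrix (Fin m) (Fin l) ℝ}
    {N : α → Matrix (Fin m) (Fin n) ℝ} (hA : Measurable A) (hY : Measurable Y)
    (hN : Measurable N) : Measurable fun x => noisyProj ρ (A x) (Y x) (N x) :=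
  measurable_matrix_mul (measurable_colProj hY) (measurable_matrix_add hA
    (measurable_matrix_smul ((measurable_colProjWidth hY).div_const ρ) hN))

/-- Every matrix can be moved, measurably, to a matrix of rank `k` at almost minimal distance. -/
theorem exists_measurable_rank_eq (m n k : ℕ) :
    ∃ f : Matrix (Fin m) (Fin n) ℝ → Matrix (Fin m) (Fin n) ℝ, Measurable f ∧
      (Set.range f).Countable ∧
      ∀ X : Matrix (Fin m) (Fin n) ℝ, X.rank = k → ∀ B, (f B).rank = k ∧
        frobNorm (B - f B) ≤ frobNorm (B - X) + 1 := by
  classical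
  by_cases hne : ∃ X : Matrix (Fin m) (Fin n) ℝ, X.rank = k
  swap
  · exact ⟨fun _ => 0, measurable_const, (Set.countable_singleton 0).mono
      (by rintro _ ⟨_, rfl⟩; rfl), fun X hX => absurd ⟨X, hX⟩ hne⟩
  let T : Set (EuclideanSpace ℝ (Fin m × Fin n)) := {g | (matrixOfVec g).rank = k}
  let vec : Matrix (Fin m) (Fin n) ℝ → EuclideanSpace ℝ (Fin m × Fin n) :=
    fun B => WithLp.toLp 2 fun s => B s.1 s.2
  have hvec : Measurable vec := by
    have h1 : Measurable fun (B : Matrix (Fin m) (Fin n) ℝ) (s : Fin m × Fin n) => B s.1 s.2 :=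
      measurable_pi_iff.2 fun s => measurable_entry measurable_id s.1 s.2
    exact (WithLp.measurable_toLp 2 _).comp h1
  have hmv : ∀ B, matrixOfVec (vec B) = B := fun B => rfl
  have hdist : ∀ B g, dist (vec B) g = frobNorm (B - matrixOfVec g) := fun B g => by
    rw [dist_eq_norm, frobNorm_eq_norm]; rfl
  have : Nonempty T := by
    obtain ⟨X, hX⟩ := hne
    exact ⟨⟨vec X, hX⟩⟩
  have hex : ∀ B, ∃ i, dist (vec B) (TopologicalSpace.denseSeq T i) <
      Metric.infDist (vec B) T + 1 := by
    intro B
    obtain ⟨y, hy, hyd⟩ := (Metric.infDist_lt_iff (Set.nonempty_coe_sort.1 this)).1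
      (lt_add_one (Metric.infDist (vec B) T))
    have hopen : IsOpen {y : T | dist (vec B) y < Metric.infDist (vec B) T + 1} :=
      isOpen_lt (by fun_prop) continuous_const
    obtain ⟨i, hi⟩ := (TopologicalSpace.denseRange_denseSeq T).exists_mem_open hopen ⟨⟨y, hy⟩, hyd⟩
    exact ⟨i, hi⟩
  refine ⟨fun B => matrixOfVec (TopologicalSpace.denseSeq T (Nat.find (hex B))).1, ?_, ?_, ?_⟩
  · refine Measurable.find (f := fun i _ => matrixOfVec (TopologicalSpace.denseSeq T i).1)
      (p := fun i B => dist (vec B) (TopologicalSpace.denseSeq T i) <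
        Metric.infDist (vec B) T + 1) (fun _ => measurable_const) (fun i => ?_) hex
    exact measurableSet_lt (hvec.dist measurable_const)
      (((Metric.continuous_infDist_pt T).measurable.comp hvec).add_const 1)
  · refine (Set.countable_range fun i => matrixOfVec (TopologicalSpace.denseSeq T i).1).mono ?_
    rintro _ ⟨B, rfl⟩
    exact ⟨_, rfl⟩
  · intro X hX B
    refine ⟨(TopologicalSpace.denseSeq T (Nat.find (hex B))).2, ?_⟩
    have h1 := Nat.find_spec (hex B)
    rw [hdist] at h1
    have h2 : Metric.infDist (vec B) T ≤ frobNorm (B - X) := by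
      have h3 := Metric.infDist_le_dist_of_mem (x := vec B) (show vec X ∈ T from hX)
      rwa [hdist, hmv] at h3
    linarith

/-- Rounding to a matrix of rank `k`, see `exists_measurable_rank_eq`. -/
noncomputable def roundRank (m n k : ℕ) :
    Matrix (Fin m) (Fin n) ℝ → Matrix (Fin m) (Fin n) ℝ :=
  (exists_measurable_rank_eq m n k).choose

theorem measurable_roundRank (m n k : ℕ) : Measurable (roundRank m n k) :=
  (exists_measurable_rank_eq m n k).choose_spec.1

/-- The law of all the noise used by the algorithm. -/
noncomputable def noiseLaw (m n l : ℕ) :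
    Measure (Matrix (Fin n) (Fin l) ℝ × Matrix (Fin m) (Fin l) ℝ × Matrix (Fin m) (Fin n) ℝ) :=
  (gaussianMatrix n l).prod ((gaussianMatrix m l).prod (gaussianMatrix m n))

instance isProbabilityMeasure_noiseLaw : IsProbabilityMeasure (noiseLaw m n l) := by
  unfold noiseLaw
  infer_instance

/-- The output of the algorithm as a function of the input and the noise. -/
noncomputable def outputMap (k : ℕ) (σ ρ : ℝ) (x : Matrix (Fin m) (Fin n) ℝ ×
    Matrix (Fin n) (Fin l) ℝ × Matrix (Fin m) (Fin l) ℝ × Matrix (Fin m) (Fin n) ℝ) :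
    Matrix (Fin m) (Fin n) ℝ :=
  roundRank m n k (noisyProj ρ x.1 (sketch σ x.1 x.2.1 x.2.2.1) x.2.2.2)

theorem measurable_outputMap (k : ℕ) (σ ρ : ℝ) :
    Measurable (outputMap (m := m) (n := n) (l := l) k σ ρ) :=
  (measurable_roundRank m n k).comp (measurable_noisyProj ρ measurable_fst
    (measurable_sketch σ measurable_fst (by fun_prop) (by fun_prop)) (by fun_prop))

/-- The algorithm with `l` columns in its sketch, output rank `k`, and noise parameters `σ`, `ρ`. -/
noncomputable def mechanism (m n l k : ℕ) (σ ρ : ℝ) :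
    Kernel (Matrix (Fin m) (Fin n) ℝ) (Matrix (Fin m) (Fin n) ℝ) :=
  (Kernel.id ×ₖ Kernel.const _ (noiseLaw m n l)).map (outputMap k σ ρ)

instance isMarkovKernel_mechanism (m n l k : ℕ) (σ ρ : ℝ) :
    IsMarkovKernel (mechanism m n l k σ ρ) :=
  Kernel.IsMarkovKernel.map _ (measurable_outputMap k σ ρ)

theorem mechanism_apply (k : ℕ) (σ ρ : ℝ) (A : Matrix (Fin m) (Fin n) ℝ) :
    mechanism m n l k σ ρ A = (noiseLaw m n l).map fun ω => outputMap k σ ρ (A, ω) := by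
  rw [mechanism, Kernel.map_apply _ (measurable_outputMap k σ ρ), Kernel.prod_apply,
    Kernel.id_apply, Kernel.const_apply, Measure.dirac_prod,
    Measure.map_map (measurable_outputMap k σ ρ) (by fun_prop)]
  rfl

end Mechanism

/-! ### Privacy -/

section Privacy

variable {m n l a b : ℕ}

theorem lintegral_gaussianMatrix_translate_le (W : Matrix (Fin a) (Fin b) ℝ)
    {ε ℓ ρ : ℝ} (hε : 0 < ε) (hε1 : ε < 1) (hℓ : 1 ≤ ℓ) (hρ : 0 < ρ)
    (hρε : ρ ^ 2 * (8 * ℓ) = ε ^ 2) (hW : frobNorm W ≤ ρ)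
    {f : Matrix (Fin a) (Fin b) ℝ → ℝ≥0∞} (hf : Measurable f) (hf1 : ∀ N, f N ≤ 1) :
    ∫⁻ N, f (N + W) ∂(gaussianMatrix a b) ≤
      ENNReal.ofReal (Real.exp ε) * ∫⁻ N, f N ∂(gaussianMatrix a b) +
        ENNReal.ofReal (Real.exp (-ℓ)) := by
  rw [frobNorm_eq_norm] at hW
  rw [lintegral_gaussianMatrix hf, lintegral_gaussianMatrix (f := fun N => f (N + W))
    (hf.comp (measurable_matrix_add measurable_id measurable_const))]
  exact lintegral_stdGaussian_translate_le _ hε hε1 hℓ hρ hρε hW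
    (hf.comp measurable_matrixOfVec) (fun _ => hf1 _)

theorem gaussianMatrix_translate_le (W : Matrix (Fin a) (Fin b) ℝ)
    {ε ℓ ρ : ℝ} (hε : 0 < ε) (hε1 : ε < 1) (hℓ : 1 ≤ ℓ) (hρ : 0 < ρ)
    (hρε : ρ ^ 2 * (8 * ℓ) = ε ^ 2) (hW : frobNorm W ≤ ρ)
    {S : Set (Matrix (Fin a) (Fin b) ℝ)} (hS : MeasurableSet S) :
    gaussianMatrix a b {N | N + W ∈ S} ≤
      ENNReal.ofReal (Real.exp ε) * gaussianMatrix a b S + ENNReal.ofReal (Real.exp (-ℓ)) := by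
  have h := lintegral_gaussianMatrix_translate_le W hε hε1 hℓ hρ hρε hW
    (f := S.indicator 1) (measurable_one.indicator hS)
    (fun N => Set.indicator_le' (fun _ _ => le_rfl) (fun _ _ => zero_le) N)
  rw [lintegral_indicator_one hS] at h
  have hS' : MeasurableSet {N | N + W ∈ S} :=
    (measurable_matrix_add measurable_id measurable_const) hS
  rw [← lintegral_indicator_one hS']
  exact h

/-- Neighboring matrices differ by a rank-one matrix supported on a single row. -/
theorem Neighboring.exists_sub {A A' : Matrix (Fin m) (Fin n) ℝ} (h : Neighboring A A') :
    ∃ (i : Fin m) (u : Fin n → ℝ), ∑ j, u j ^ 2 ≤ 1 ∧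
      A - A' = Matrix.vecMulVec (Pi.single i 1) u := by
  obtain ⟨i, hi, hne⟩ := h
  refine ⟨i, fun j => A i j - A' i j, ?_, ?_⟩
  · rwa [Real.sqrt_le_left zero_le_one, one_pow] at hi
  · ext i' j
    rw [Matrix.vecMulVec_apply, Matrix.sub_apply]
    by_cases h : i' = i
    · subst h; simp
    · simp [h, hne i' h j]

/-- The second phase is private, since its noise is adapted to the coherence of `Y`. -/
theorem noisyProj_private {A A' : Matrix (Fin m) (Fin n) ℝ} (hA : Neighboring A A')
    (Y : Matrix (Fin m) (Fin l) ℝ)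
    {ε ℓ ρ : ℝ} (hε : 0 < ε) (hε1 : ε < 1) (hℓ : 1 ≤ ℓ) (hρ : 0 < ρ)
    (hρε : ρ ^ 2 * (8 * ℓ) = ε ^ 2) {S : Set (Matrix (Fin m) (Fin n) ℝ)} (hS : MeasurableSet S) :
    gaussianMatrix m n {N | noisyProj ρ A Y N ∈ S} ≤
      ENNReal.ofReal (Real.exp ε) * gaussianMatrix m n {N | noisyProj ρ A' Y N ∈ S} +
        ENNReal.ofReal (Real.exp (-ℓ)) := by
  obtain ⟨i, u, hu, hAA⟩ := hA.exists_sub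
  set P := colProj Y with hP
  set s := colProjWidth Y with hs
  have hcol : ∑ j, P j i ^ 2 ≤ s ^ 2 := by
    have h := sqrt_sum_colProj_sq_le Y i
    rwa [Real.sqrt_le_left (colProjWidth_nonneg Y)] at h
  have hPW : frobNorm (P * (A - A')) ≤ s := by
    refine (sq_le_sq₀ (frobNorm_nonneg _) (colProjWidth_nonneg Y)).1 ?_
    rw [hAA, Matrix.mul_vecMulVec, frobNorm_sq]
    simp only [Matrix.vecMulVec_apply, Matrix.mulVec_single_one, Matrix.col_apply, mul_pow]
    simp_rw [← Finset.mul_sum, ← Finset.sum_mul]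
    calc (∑ j, P j i ^ 2) * ∑ j, u j ^ 2 ≤ s ^ 2 * 1 :=
          mul_le_mul hcol hu (Finset.sum_nonneg fun _ _ => sq_nonneg _) (sq_nonneg _)
      _ = s ^ 2 := mul_one _
  rcases (colProjWidth_nonneg Y).eq_or_lt with h0 | hpos
  · have hP0 : P = 0 := by
      ext j j'
      have h := sqrt_sum_colProj_sq_le Y j'
      rw [← h0, Real.sqrt_le_left le_rfl] at h
      have h1 : P j j' ^ 2 ≤ 0 := by
        refine (Finset.single_le_sum (f := fun j => P j j' ^ 2) (fun _ _ => sq_nonneg _)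
          (Finset.mem_univ j)).trans ?_
        simpa using h
      simpa using pow_eq_zero_iff two_ne_zero |>.1 (le_antisymm h1 (sq_nonneg _))
    have hz : ∀ B N : Matrix (Fin m) (Fin n) ℝ, noisyProj ρ B Y N = 0 := fun B N => by
      rw [noisyProj, ← hP, hP0, Matrix.zero_mul]
    simp only [hz]
    refine le_add_of_le_of_nonneg ?_ zero_le
    refine le_mul_of_one_le_left' ?_
    rw [ENNReal.one_le_ofReal]
    exact Real.one_le_exp hε.le
  · set W := (ρ / s) • (P * (A - A')) with hW
    have hWn : frobNorm W ≤ ρ := by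
      rw [hW, frobNorm_smul, abs_of_pos (by positivity)]
      calc ρ / s * frobNorm (P * (A - A')) ≤ ρ / s * s := by gcongr
        _ = ρ := by rw [div_mul_cancel₀ _ hpos.ne']
    have hshift : ∀ N, noisyProj ρ A Y N = noisyProj ρ A' Y (N + W) := by
      intro N
      have h1 : (s / ρ) • W = P * (A - A') := by
        rw [hW, smul_smul, div_mul_div_cancel₀ hρ.ne', div_self hpos.ne', one_smul]
      rw [noisyProj, noisyProj, ← hP, ← hs, smul_add, h1, Matrix.mul_add, Matrix.mul_add,
        Matrix.mul_add, ← Matrix.mul_assoc P P, hP, colProj_mul_self, Matrix.mul_sub]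
      abel
    simp_rw [hshift]
    exact gaussianMatrix_translate_le W hε hε1 hℓ hρ hρε hWn
      (measurable_noisyProj ρ measurable_const measurable_const measurable_id hS)

/-- The first phase is private conditionally on `Ω`, unless `Ω` stretches the direction in which the
inputs differ. -/
theorem sketch_private {A A' : Matrix (Fin m) (Fin n) ℝ} {i : Fin m} {u : Fin n → ℝ}
    (hAA : A - A' = Matrix.vecMulVec (Pi.single i 1) u) (Ω : Matrix (Fin n) (Fin l) ℝ)
    {ε ℓ ρ σ : ℝ} (hε : 0 < ε) (hε1 : ε < 1) (hℓ : 1 ≤ ℓ) (hρ : 0 < ρ)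
    (hρε : ρ ^ 2 * (8 * ℓ) = ε ^ 2) (hσ : 0 < σ)
    (hΩ : ∑ j, (Matrix.vecMul u Ω) j ^ 2 ≤ (σ * ρ) ^ 2)
    {f : Matrix (Fin m) (Fin l) ℝ → ℝ≥0∞} (hf : Measurable f) (hf1 : ∀ N, f N ≤ 1) :
    ∫⁻ N, f (sketch σ A Ω N) ∂(gaussianMatrix m l) ≤
      ENNReal.ofReal (Real.exp ε) * ∫⁻ N, f (sketch σ A' Ω N) ∂(gaussianMatrix m l) +
        ENNReal.ofReal (Real.exp (-ℓ)) := by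
  set W := σ⁻¹ • ((A - A') * Ω) with hW
  have hWn : frobNorm W ≤ ρ := by
    have h1 : frobNorm ((A - A') * Ω) ≤ σ * ρ := by
      refine (sq_le_sq₀ (frobNorm_nonneg _) (by positivity)).1 ?_
      rw [hAA, Matrix.vecMulVec_mul, frobNorm_sq]
      simp only [Matrix.vecMulVec_apply, mul_pow]
      simp_rw [← Finset.mul_sum, ← Finset.sum_mul]
      have h2 : ∑ j : Fin m, (Pi.single i (1 : ℝ) : Fin m → ℝ) j ^ 2 = 1 := by
        simp [Pi.single_apply]
      rw [h2, one_mul, ← mul_pow]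
      exact hΩ
    rw [hW, frobNorm_smul, abs_of_pos (by positivity), inv_mul_le_iff₀ hσ]
    exact h1
  have hshift : ∀ N, sketch σ A Ω N = sketch σ A' Ω (N + W) := by
    intro N
    rw [sketch, sketch, smul_add, hW, smul_smul, mul_inv_cancel₀ hσ.ne', one_smul,
      Matrix.sub_mul]
    abel
  simp_rw [hshift]
  exact lintegral_gaussianMatrix_translate_le (f := fun N => f (sketch σ A' Ω N)) W hε hε1 hℓ hρ
    hρε hWn (hf.comp (measurable_sketch σ measurable_const measurable_const measurable_id))
    (fun _ => hf1 _)

/-- The privacy of the algorithm, by composition of its two phases. -/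
theorem mechanism_isDP (k : ℕ) {ε δ ρ σ : ℝ} (hε : 0 < ε) (hε1 : ε < 1) (hδ : 0 < δ)
    (hδ1 : δ < 1) (hρ : 0 < ρ) (hρε : ρ ^ 2 * (8 * Real.log (4 / δ)) = (ε / 2) ^ 2) (hσ : 0 < σ)
    (hσρ : (σ * ρ) ^ 2 = 4 * (l + Real.log (4 / δ))) :
    IsDP ε δ (mechanism m n l k σ ρ) := by
  intro A A' hA S hS
  have hℓ : 1 ≤ Real.log (4 / δ) := by
    rw [Real.le_log_iff_exp_le (by positivity), le_div_iff₀ hδ]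
    nlinarith [Real.exp_one_lt_three, Real.exp_pos 1]
  have hexpℓ : Real.exp (-Real.log (4 / δ)) = δ / 4 := by
    rw [Real.exp_neg, Real.exp_log (by positivity), inv_div]
  set S' := roundRank m n k ⁻¹' S with hS'def
  have hS' : MeasurableSet S' := measurable_roundRank m n k hS
  set h : Matrix (Fin m) (Fin n) ℝ → Matrix (Fin m) (Fin l) ℝ → ℝ≥0∞ :=
    fun B Y => gaussianMatrix m n {N | noisyProj ρ B Y N ∈ S'} with hh
  have hhm : ∀ B, Measurable (h B) := fun B =>
    measurable_measure_prodMk_left (ν := gaussianMatrix m n)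
      (measurable_noisyProj ρ measurable_const measurable_fst measurable_snd hS')
  have hval : ∀ B, mechanism m n l k σ ρ B S =
      ∫⁻ Ω, ∫⁻ N, h B (sketch σ B Ω N) ∂(gaussianMatrix m l) ∂(gaussianMatrix n l) := by
    intro B
    have hmo : Measurable fun ω : Matrix (Fin n) (Fin l) ℝ × Matrix (Fin m) (Fin l) ℝ ×
        Matrix (Fin m) (Fin n) ℝ => outputMap k σ ρ (B, ω) :=
      (measurable_outputMap k σ ρ).comp (by fun_prop)
    rw [mechanism_apply, Measure.map_apply hmo hS, noiseLaw, Measure.prod_apply (hmo hS)]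
    refine lintegral_congr fun Ω => ?_
    rw [Measure.prod_apply ((hmo hS).preimage (by fun_prop))]
    rfl
  rw [hval, hval]
  obtain ⟨i, u, hu, hAA⟩ := hA.exists_sub
  set c := ENNReal.ofReal (Real.exp (ε / 2)) with hc
  set D := ENNReal.ofReal (δ / 4) with hD
  set bad : Set (Matrix (Fin n) (Fin l) ℝ) :=
    {Ω | 4 * (l + Real.log (4 / δ)) ≤ ∑ j, (Matrix.vecMul u Ω) j ^ 2} with hbad
  have hbadm : MeasurableSet bad := by
    refine measurableSet_le measurable_const (Finset.measurable_fun_sum _ fun j _ => ?_)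
    simp only [Matrix.vecMul, dotProduct]
    exact (Finset.measurable_fun_sum _ fun i _ =>
      (measurable_entry measurable_id i j).const_mul _).pow_const 2
  have hbadle : gaussianMatrix n l bad ≤ D := by
    rw [hD, ← hexpℓ]
    exact gaussianMatrix_sum_vecMul_sq_tail hu _
  have hsk : ∀ B Ω, Measurable fun N => h B (sketch σ B Ω N) := fun B Ω =>
    (hhm B).comp (measurable_sketch σ measurable_const measurable_const measurable_id)
  have hsk' : Measurable fun Ω => ∫⁻ N, h A' (sketch σ A' Ω N) ∂(gaussianMatrix m l) :=
    Measurable.lintegral_prod_right ((hhm A').comp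
      (measurable_sketch σ measurable_const measurable_fst measurable_snd))
  have hΩ : ∀ Ω, ∫⁻ N, h A (sketch σ A Ω N) ∂(gaussianMatrix m l) ≤
      bad.indicator 1 Ω +
        (c * (c * ∫⁻ N, h A' (sketch σ A' Ω N) ∂(gaussianMatrix m l) + D) + D) := by
    intro Ω
    by_cases hb : Ω ∈ bad
    · rw [Set.indicator_of_mem hb]
      refine le_add_of_le_of_nonneg ?_ zero_le
      calc ∫⁻ N, h A (sketch σ A Ω N) ∂(gaussianMatrix m l)
          ≤ ∫⁻ _N, 1 ∂(gaussianMatrix m l) := lintegral_mono fun _ => prob_le_one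
        _ = 1 := by simp
    · rw [Set.indicator_of_notMem hb, zero_add]
      have h1 := sketch_private (ε := ε / 2) hAA Ω (by linarith) (by linarith) hℓ hρ hρε hσ
        (by rw [hσρ]; exact (not_le.1 hb).le) (hhm A) (fun _ => prob_le_one)
      rw [hexpℓ] at h1
      refine h1.trans ?_
      gcongr
      calc ∫⁻ N, h A (sketch σ A' Ω N) ∂(gaussianMatrix m l)
          ≤ ∫⁻ N, (c * h A' (sketch σ A' Ω N) + D) ∂(gaussianMatrix m l) := by
            refine lintegral_mono fun N => ?_
            have h2 := noisyProj_private (ε := ε / 2) hA (sketch σ A' Ω N) (by linarith)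
              (by linarith) hℓ hρ hρε hS'
            rwa [hexpℓ] at h2
        _ = _ := by
            rw [lintegral_add_right _ measurable_const, lintegral_const_mul _ (hsk A' Ω)]
            simp
  refine (lintegral_mono hΩ).trans ?_
  rw [lintegral_add_left (measurable_one.indicator hbadm), lintegral_indicator_one hbadm,
    lintegral_add_right _ measurable_const,
    lintegral_const_mul _ ((hsk'.const_mul c).add_const D),
    lintegral_add_right _ measurable_const, lintegral_const_mul _ hsk']
  simp only [lintegral_const, measure_univ, mul_one]
  set J := ∫⁻ Ω, ∫⁻ N, h A' (sketch σ A' Ω N) ∂(gaussianMatrix m l) ∂(gaussianMatrix n l)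
  have hcc : c * c = ENNReal.ofReal (Real.exp ε) := by
    rw [hc, ← ENNReal.ofReal_mul (Real.exp_pos _).le, ← Real.exp_add, add_halves]
  have hc2 : c ≤ 2 := by
    rw [hc, ← ENNReal.ofReal_ofNat 2]
    apply ENNReal.ofReal_le_ofReal
    have h3 : Real.exp (ε / 2) ≤ Real.exp (1 / 2) := Real.exp_le_exp.2 (by linarith)
    have h4 : Real.exp (1 / 2) * Real.exp (1 / 2) = Real.exp 1 := by
      rw [← Real.exp_add]; norm_num
    nlinarith [Real.exp_one_lt_three, Real.exp_pos (1 / 2)]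
  have h4D : D + D + (D + D) = ENNReal.ofReal δ := by
    rw [hD, ← ENNReal.ofReal_add (by positivity) (by positivity),
      ← ENNReal.ofReal_add (by positivity) (by positivity)]
    congr 1
    ring
  calc gaussianMatrix n l bad + (c * (c * J + D) + D)
      ≤ D + (c * (c * J + D) + D) := by gcongr
    _ = c * c * J + (D + D + c * D) := by ring
    _ ≤ c * c * J + (D + D + 2 * D) := by gcongr
    _ = ENNReal.ofReal (Real.exp ε) * J + ENNReal.ofReal δ := by
        rw [hcc, ← h4D, two_mul]

end Privacy

/-! ### Range finding and coherence -/

section LinearAlgebra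

variable {m n l a b d q : ℕ}

theorem frobNorm_sq_eq_trace (A : Matrix (Fin a) (Fin b) ℝ) :
    frobNorm A ^ 2 = (A.transpose * A).trace := by
  rw [frobNorm_sq, Finset.sum_comm]
  simp [Matrix.trace, Matrix.mul_apply, pow_two]

theorem frobNorm_sub_colProj_mul_le (Y : Matrix (Fin m) (Fin l) ℝ)
    (Z : Matrix (Fin m) (Fin n) ℝ) : frobNorm (Z - colProj Y * Z) ≤ frobNorm Z := by
  refine (sq_le_sq₀ (frobNorm_nonneg _) (frobNorm_nonneg _)).1 ?_
  have h : frobNorm (Z - colProj Y * Z) ^ 2 + frobNorm (colProj Y * Z) ^ 2 = frobNorm Z ^ 2 := by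
    rw [frobNorm_sq_eq_trace, frobNorm_sq_eq_trace, frobNorm_sq_eq_trace, ← Matrix.trace_add]
    congr 1
    simp only [Matrix.transpose_sub, Matrix.transpose_mul, colProj_transpose, Matrix.sub_mul,
      Matrix.mul_sub, Matrix.mul_assoc]
    simp only [← Matrix.mul_assoc (colProj Y) (colProj Y), colProj_mul_self]
    abel
  nlinarith [sq_nonneg (frobNorm (colProj Y * Z))]

/-- Projecting `A` to the column space of `Y` is at least as good as every approximation of the form
`Y S`. -/
theorem frobNorm_sub_colProj_mul_self_le (Y : Matrix (Fin m) (Fin l) ℝ)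
    (hY : IsUnit (Y.transpose * Y).det) (A : Matrix (Fin m) (Fin n) ℝ)
    (S : Matrix (Fin l) (Fin n) ℝ) : frobNorm (A - colProj Y * A) ≤ frobNorm (A - Y * S) := by
  have h : A - colProj Y * A = (A - Y * S) - colProj Y * (A - Y * S) := by
    rw [Matrix.mul_sub, ← Matrix.mul_assoc, colProj_mul Y hY]
    abel
  rw [h]
  exact frobNorm_sub_colProj_mul_le _ _

theorem sum_mulVec_sq_eq (M : Matrix (Fin a) (Fin b) ℝ) (x : Fin b → ℝ) :
    ∑ i, (M.mulVec x) i ^ 2 = x ⬝ᵥ (M.transpose * M).mulVec x := by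
  rw [← Matrix.mulVec_mulVec, Matrix.dotProduct_mulVec, Matrix.vecMul_transpose]
  simp [dotProduct, pow_two]

/-- A matrix that is bounded below has an invertible Gram matrix. -/
theorem isUnit_det_transpose_mul_self {M : Matrix (Fin a) (Fin b) ℝ} {c : ℝ} (hc : 0 < c)
    (hM : ∀ x : Fin b → ℝ, c * ∑ j, x j ^ 2 ≤ ∑ i, (M.mulVec x) i ^ 2) :
    IsUnit (M.transpose * M).det := by
  rw [← Matrix.isUnit_iff_isUnit_det, ← Matrix.mulVec_injective_iff_isUnit]
  intro x y hxy
  have h0 : (M.transpose * M).mulVec (x - y) = 0 := by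
    rw [Matrix.mulVec_sub, sub_eq_zero]
    exact hxy
  have h1 := hM (x - y)
  rw [sum_mulVec_sq_eq, h0, dotProduct_zero] at h1
  have h2 : ∑ j, (x - y) j ^ 2 = 0 :=
    le_antisymm (by nlinarith) (Finset.sum_nonneg fun _ _ => sq_nonneg _)
  ext j
  have h3 := (Finset.sum_eq_zero_iff_of_nonneg (fun j _ => sq_nonneg ((x - y) j))).1 h2 j
    (Finset.mem_univ j)
  have h4 := pow_eq_zero_iff two_ne_zero |>.1 h3
  rwa [Pi.sub_apply, sub_eq_zero] at h4

/-- A wide matrix whose transpose is bounded below has a right inverse of small operator norm. -/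
theorem exists_right_inverse {G : Matrix (Fin d) (Fin l) ℝ} {c : ℝ} (hc : 0 < c)
    (hG : ∀ x : Fin d → ℝ, c * ∑ j, x j ^ 2 ≤ ∑ i, (G.transpose.mulVec x) i ^ 2) :
    ∃ F : Matrix (Fin l) (Fin d) ℝ, G * F = 1 ∧
      ∀ Z : Matrix (Fin a) (Fin l) ℝ, c * frobNorm (Z * F) ^ 2 ≤ frobNorm Z ^ 2 := by
  have hunit : IsUnit (G * G.transpose).det := by
    simpa using isUnit_det_transpose_mul_self hc hG
  refine ⟨G.transpose * (G * G.transpose)⁻¹, ?_, fun Z => ?_⟩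
  · rw [← Matrix.mul_assoc, Matrix.mul_nonsing_inv _ hunit]
  rw [frobNorm_sq, frobNorm_sq, Finset.mul_sum]
  refine Finset.sum_le_sum fun i _ => ?_
  set z : Fin l → ℝ := Z i with hz
  set y : Fin d → ℝ := (G * G.transpose)⁻¹.mulVec (G.mulVec z) with hy
  have hrow : ∀ j, (Z * (G.transpose * (G * G.transpose)⁻¹)) i j = y j := by
    intro j
    have h1 : (Z * (G.transpose * (G * G.transpose)⁻¹)) i j =
        Matrix.vecMul z (G.transpose * (G * G.transpose)⁻¹) j := rfl
    rw [h1, ← Matrix.mulVec_transpose, hy, Matrix.mulVec_mulVec, Matrix.transpose_mul,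
      Matrix.transpose_nonsing_inv, Matrix.transpose_mul, Matrix.transpose_transpose]
  simp_rw [hrow]
  refine (hG y).trans ?_
  set w := G.transpose.mulVec y with hw
  have h1 : G.mulVec w = G.mulVec z := by
    rw [hw, hy, Matrix.mulVec_mulVec, Matrix.mulVec_mulVec, Matrix.mul_nonsing_inv _ hunit,
      Matrix.one_mulVec]
  -- `w` is the orthogonal projection of `z` to the row space of `G`
  have h2 : w ⬝ᵥ w = w ⬝ᵥ z := by
    have h3 : ∀ t : Fin l → ℝ, w ⬝ᵥ t = y ⬝ᵥ G.mulVec t := fun t => by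
      rw [hw, Matrix.mulVec_transpose, Matrix.dotProduct_mulVec]
    rw [h3, h3, h1]
  have h4 : 0 ≤ (w - z) ⬝ᵥ (w - z) :=
    Finset.sum_nonneg fun _ _ => mul_self_nonneg _
  rw [sub_dotProduct, dotProduct_sub, dotProduct_sub, dotProduct_comm z w] at h4
  have h5 : ∀ t : Fin l → ℝ, ∑ j, t j ^ 2 = t ⬝ᵥ t := fun t => by simp [dotProduct, pow_two]
  rw [h5, h5]
  linarith

/-- A matrix whose columns form an orthonormal basis of a given subspace. -/
theorem exists_orthonormal_columns (W : Submodule ℝ (EuclideanSpace ℝ (Fin a))) :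
    ∃ V : Matrix (Fin a) (Fin (Module.finrank ℝ W)) ℝ, V.transpose * V = 1 ∧
      ∀ y : EuclideanSpace ℝ (Fin a),
        (V * V.transpose).mulVec y.ofLp = (W.starProjection y).ofLp := by
  let e := stdOrthonormalBasis ℝ W
  refine ⟨Matrix.of fun i k => (e k : EuclideanSpace ℝ (Fin a)) i, ?_, fun y => ?_⟩
  · ext k k'
    have h := orthonormal_iff_ite.1 e.orthonormal k k'
    rw [Submodule.coe_inner, PiLp.inner_apply] at h
    rw [Matrix.one_apply, ← h]
    simp [Matrix.mul_apply, mul_comm]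
  · rw [← Matrix.mulVec_mulVec]
    have h := e.sum_repr (W.orthogonalProjectionOnto y)
    have h2 : W.starProjection y = ∑ k, ⟪(e k : EuclideanSpace ℝ (Fin a)), y⟫ •
        (e k : EuclideanSpace ℝ (Fin a)) := by
      rw [Submodule.starProjection_apply, ← h, Submodule.coe_sum]
      refine Finset.sum_congr rfl fun k _ => ?_
      rw [e.repr_apply_apply, Submodule.coe_smul, Submodule.coe_inner]
      congr 1
      exact Submodule.inner_starProjection_left_eq_right W _ _ |>.symm.trans (by
        rw [Submodule.starProjection_eq_self_iff.2 (e k).2])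
    rw [h2]
    ext i
    simp [Matrix.mulVec, dotProduct, PiLp.inner_apply, mul_comm]

/-- An orthonormal basis of the row space. -/
theorem exists_orthonormal_rowSpace (X : Matrix (Fin m) (Fin n) ℝ) :
    ∃ (d : ℕ) (V : Matrix (Fin n) (Fin d) ℝ), d = X.rank ∧ V.transpose * V = 1 ∧
      X * (V * V.transpose) = X := by
  let K := LinearMap.ker (Matrix.toEuclideanLin X)
  obtain ⟨V, hV, hVp⟩ := exists_orthonormal_columns Kᗮ
  refine ⟨_, V, ?_, hV, ?_⟩
  · have h1 := LinearMap.finrank_range_add_finrank_ker (Matrix.toEuclideanLin X)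
    have h2 := K.finrank_add_finrank_orthogonal
    have h3 : X.rank = Module.finrank ℝ (LinearMap.range (Matrix.toEuclideanLin X)) := by
      rw [Matrix.rank_eq_finrank_range_toLin X
        (EuclideanSpace.basisFun (Fin m) ℝ).toBasis (EuclideanSpace.basisFun (Fin n) ℝ).toBasis]
      rfl
    change Module.finrank ℝ K + _ = _ at h2
    change _ + Module.finrank ℝ K = _ at h1
    omega
  · apply Matrix.ext_of_mulVec_single
    intro j
    rw [← Matrix.mulVec_mulVec]
    have h1 := hVp (EuclideanSpace.single j 1)
    have h2 : (EuclideanSpace.single j 1 : EuclideanSpace ℝ (Fin n)).ofLp = Pi.single j 1 := by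
      simp
    rw [h2] at h1
    rw [h1]
    have h3 : EuclideanSpace.single j 1 - Kᗮ.starProjection (EuclideanSpace.single j 1) ∈ K := by
      have := Submodule.sub_starProjection_mem_orthogonal (K := Kᗮ)
        (EuclideanSpace.single j (1 : ℝ))
      rwa [Submodule.orthogonal_orthogonal] at this
    have h4 : Matrix.toEuclideanLin X (EuclideanSpace.single j 1 -
      Kᗮ.starProjection (EuclideanSpace.single j 1)) = 0 := h3
    rw [map_sub, sub_eq_zero] at h4
    have h5 := congrArg WithLp.ofLp h4
    rw [Matrix.toLpLin_apply, Matrix.toLpLin_apply] at h5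
    simp only [h2] at h5
    exact h5.symm

/-- An orthonormal basis of the orthogonal complement of the column space. -/
theorem exists_orthonormal_colSpace_compl (A : Matrix (Fin m) (Fin n) ℝ) :
    ∃ (q : ℕ) (U : Matrix (Fin m) (Fin q) ℝ), q + A.rank = m ∧ U.transpose * U = 1 ∧
      U.transpose * A = 0 ∧ ∀ i, ∑ j, ((1 : Matrix (Fin m) (Fin m) ℝ) - U * U.transpose) j i ^ 2 =
        ‖(colSpace A).starProjection (EuclideanSpace.single i (1 : ℝ))‖ ^ 2 := by
  obtain ⟨U, hU, hUp⟩ := exists_orthonormal_columns (colSpace A)ᗮ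
  refine ⟨_, U, ?_, hU, ?_, ?_⟩
  · have h2 := (colSpace A).finrank_add_finrank_orthogonal
    have h3 : A.rank = Module.finrank ℝ (colSpace A) := by
      rw [colSpace, Matrix.rank_eq_finrank_range_toLin A
        (EuclideanSpace.basisFun (Fin m) ℝ).toBasis (EuclideanSpace.basisFun (Fin n) ℝ).toBasis]
      rfl
    rw [finrank_euclideanSpace_fin] at h2
    omega
  · have h1 : U * U.transpose * A = 0 := by
      apply Matrix.ext_of_mulVec_single
      intro j
      have h2 := hUp (Matrix.toEuclideanLin A (WithLp.toLp 2 (Pi.single j 1)))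
      rw [← Matrix.mulVec_mulVec, Matrix.zero_mulVec]
      rw [Matrix.toLpLin_apply] at h2
      refine h2.trans ?_
      have h3 : WithLp.toLp 2 (A.mulVec (Pi.single j 1)) ∈ colSpace A :=
        ⟨WithLp.toLp 2 (Pi.single j 1), by rw [Matrix.toLpLin_apply]⟩
      have h4 := Submodule.starProjection_orthogonal_apply_eq_zero (K := colSpace A) h3
      simp only at h4 ⊢
      rw [h4]
      rfl
    calc U.transpose * A = (U.transpose * U) * (U.transpose * A) := by rw [hU, Matrix.one_mul]
      _ = U.transpose * (U * U.transpose * A) := by simp only [Matrix.mul_assoc]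
      _ = 0 := by rw [h1, Matrix.mul_zero]
  · intro i
    rw [EuclideanSpace.real_norm_sq_eq]
    refine Finset.sum_congr rfl fun j _ => ?_
    have h1 := congrFun (hUp (EuclideanSpace.single i 1)) j
    have h2 : (EuclideanSpace.single i 1 : EuclideanSpace ℝ (Fin m)).ofLp = Pi.single i 1 := by
      simp
    rw [h2, Matrix.mulVec_single_one, Matrix.col_apply] at h1
    rw [Matrix.sub_apply, h1, Submodule.starProjection_orthogonal_val]
    simp [Matrix.one_apply]

theorem frobNorm_mul_transpose {V : Matrix (Fin n) (Fin d) ℝ} (hV : V.transpose * V = 1)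
    (Z : Matrix (Fin m) (Fin d) ℝ) : frobNorm (Z * V.transpose) = frobNorm Z := by
  refine (sq_eq_sq₀ (frobNorm_nonneg _) (frobNorm_nonneg _)).1 ?_
  rw [frobNorm_sq_eq_trace, frobNorm_sq_eq_trace, Matrix.transpose_mul, Matrix.transpose_transpose,
    Matrix.mul_assoc, Matrix.trace_mul_comm, Matrix.mul_assoc, Matrix.mul_assoc, hV,
    Matrix.mul_one]

/-- The range finder: if the sketch `Ω` is well conditioned on the row space of `X`, then
projecting to the column space of the noisy sketch of `A` is nearly as good as replacing `A`
by `X`. -/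
theorem frobNorm_sub_colProj_sketch_le {σ c : ℝ} (hσ : 0 < σ) (hc : 0 < c)
    (A X : Matrix (Fin m) (Fin n) ℝ) (Ω : Matrix (Fin n) (Fin l) ℝ) (N : Matrix (Fin m) (Fin l) ℝ)
    (hY : IsUnit ((sketch σ A Ω N).transpose * sketch σ A Ω N).det)
    {V : Matrix (Fin n) (Fin d) ℝ} (hV : V.transpose * V = 1) (hXV : X * (V * V.transpose) = X)
    (hG : ∀ x : Fin d → ℝ, c ^ 2 * ∑ j, x j ^ 2 ≤
      ∑ i, ((V.transpose * Ω).transpose.mulVec x) i ^ 2) :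
    c * frobNorm (A - colProj (sketch σ A Ω N) * A) ≤
      c * frobNorm (A - X) + (frobNorm ((A - X) * Ω) + σ * frobNorm N) := by
  obtain ⟨F, hF, hFle⟩ := exists_right_inverse (a := m) (by positivity : 0 < c ^ 2) hG
  set Z := (A - X) * Ω + σ • N with hZ
  have h1 : A - sketch σ A Ω N * (F * V.transpose) = (A - X) - Z * F * V.transpose := by
    have h2 : X * Ω * F * V.transpose = X := by
      calc X * Ω * F * V.transpose = X * (V * V.transpose) * Ω * F * V.transpose := by rw [hXV]
        _ = X * (V * ((V.transpose * Ω) * F) * V.transpose) := by simp only [Matrix.mul_assoc]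
        _ = X := by rw [hF, Matrix.mul_one, hXV]
    have h3 : sketch σ A Ω N = X * Ω + Z := by
      rw [sketch, hZ, Matrix.sub_mul]
      abel
    rw [h3, Matrix.add_mul, ← Matrix.mul_assoc, h2, ← Matrix.mul_assoc]
    abel
  have h4 : c * frobNorm (Z * F) ≤ frobNorm Z := by
    refine (sq_le_sq₀ (mul_nonneg hc.le (frobNorm_nonneg _)) (frobNorm_nonneg _)).1 ?_
    rw [mul_pow]
    exact hFle Z
  calc c * frobNorm (A - colProj (sketch σ A Ω N) * A)
      ≤ c * frobNorm ((A - X) - Z * F * V.transpose) := by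
        rw [← h1]
        gcongr
        exact frobNorm_sub_colProj_mul_self_le _ hY _ _
    _ ≤ c * (frobNorm (A - X) + frobNorm (Z * F)) := by
        gcongr
        rw [← frobNorm_mul_transpose hV (Z * F)]
        exact frobNorm_sub_le _ _
    _ ≤ c * frobNorm (A - X) + frobNorm Z := by linarith
    _ ≤ _ := by
        gcongr
        rw [hZ]
        refine (frobNorm_add_le _ _).trans_eq ?_
        rw [frobNorm_smul, abs_of_pos hσ]

theorem dotProduct_le_sqrt_mul_sqrt (x y : Fin a → ℝ) :
    x ⬝ᵥ y ≤ √(∑ i, x i ^ 2) * √(∑ i, y i ^ 2) :=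
  Real.sum_mul_le_sqrt_mul_sqrt _ _ _

/-- The column space of the noisy sketch of `A` is contained in the sum of the column spaces of `A`
and of the noise `N`. So its coherence is controlled by that of `A`, provided that `N` is well
conditioned on the orthogonal complement of the column space of `A`, which is spanned by the columns
of `U`. -/
theorem colProjWidth_sketch_le {σ c κ τ : ℝ} (hσ : 0 < σ) (hc : 0 < c) (hκ : 0 ≤ κ) (hτ : 0 ≤ τ)
    (A : Matrix (Fin m) (Fin n) ℝ) (Ω : Matrix (Fin n) (Fin l) ℝ) (N : Matrix (Fin m) (Fin l) ℝ)
    {U : Matrix (Fin m) (Fin q) ℝ} (hU : U.transpose * U = 1) (hUA : U.transpose * A = 0)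
    (hN : ∀ x : Fin l → ℝ, c ^ 2 * ∑ j, x j ^ 2 ≤ ∑ i, ((U.transpose * N).mulVec x) i ^ 2)
    (hκU : ∀ i, ∑ j, ((1 : Matrix (Fin m) (Fin m) ℝ) - U * U.transpose) j i ^ 2 ≤ κ ^ 2)
    (hτN : ∀ i, ∑ j, (U * U.transpose * N) i j ^ 2 ≤ τ ^ 2) :
    IsUnit ((sketch σ A Ω N).transpose * sketch σ A Ω N).det ∧
      colProjWidth (sketch σ A Ω N) ≤ κ + τ / c := by
  set Y := sketch σ A Ω N with hY
  have hUY : U.transpose * Y = σ • (U.transpose * N) := by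
    rw [hY, sketch, Matrix.mul_add, ← Matrix.mul_assoc, hUA, Matrix.zero_mul, zero_add,
      Matrix.mul_smul]
  -- multiplication by `Uᵀ` does not increase norms
  have hUle : ∀ v : Fin m → ℝ, ∑ i, (U.transpose.mulVec v) i ^ 2 ≤ ∑ i, v i ^ 2 := by
    intro v
    have h1 : 0 ≤ ∑ i, (v - U.mulVec (U.transpose.mulVec v)) i ^ 2 :=
      Finset.sum_nonneg fun _ _ => sq_nonneg _
    have h5 : ∀ {b : ℕ} (t : Fin b → ℝ), ∑ j, t j ^ 2 = t ⬝ᵥ t := fun t => by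
      simp [dotProduct, pow_two]
    have h6 : U.mulVec (U.transpose.mulVec v) ⬝ᵥ U.mulVec (U.transpose.mulVec v) =
        U.transpose.mulVec v ⬝ᵥ U.transpose.mulVec v := by
      rw [← h5, sum_mulVec_sq_eq, hU, Matrix.one_mulVec]
    have h7 : v ⬝ᵥ U.mulVec (U.transpose.mulVec v) =
        U.transpose.mulVec v ⬝ᵥ U.transpose.mulVec v := by
      rw [Matrix.dotProduct_mulVec, Matrix.mulVec_transpose]
    rw [h5, sub_dotProduct, dotProduct_sub, dotProduct_sub, dotProduct_comm (U.mulVec _) v, h6,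
      h7] at h1
    rw [h5, h5]
    linarith
  have hYx : ∀ x : Fin l → ℝ, σ ^ 2 * c ^ 2 * ∑ j, x j ^ 2 ≤ ∑ i, (Y.mulVec x) i ^ 2 := by
    intro x
    refine le_trans ?_ (hUle (Y.mulVec x))
    rw [Matrix.mulVec_mulVec, hUY, Matrix.smul_mulVec]
    simp only [Pi.smul_apply, smul_eq_mul, mul_pow]
    rw [← Finset.mul_sum, mul_assoc]
    gcongr
    exact hN x
  have hunit : IsUnit (Y.transpose * Y).det :=
    isUnit_det_transpose_mul_self (by positivity : 0 < σ ^ 2 * c ^ 2) hYx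
  refine ⟨hunit, Real.iSup_le (fun i => ?_) (by positivity)⟩
  set v : Fin m → ℝ := fun j => colProj Y j i with hv
  set z : Fin l → ℝ := ((Y.transpose * Y)⁻¹ * Y.transpose).mulVec (Pi.single i 1) with hz
  have hvz : v = Y.mulVec z := by
    rw [hz, Matrix.mulVec_mulVec, ← Matrix.mul_assoc]
    ext j
    simp [hv, colProj]
  have hvv : ∑ j, v j ^ 2 = v i := by
    have h1 := congrFun (congrFun (colProj_mul_self Y) i) i
    nth_rw 1 [← colProj_transpose Y] at h1
    simpa [Matrix.mul_apply, pow_two] using h1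
  have hvi : v i = v ⬝ᵥ (fun j => ((1 : Matrix (Fin m) (Fin m) ℝ) - U * U.transpose) j i) +
      (U * U.transpose).mulVec v i := by
    have hsymm : ∀ j, (U * U.transpose) i j = (U * U.transpose) j i := fun j => by
      simp [Matrix.mul_apply, mul_comm]
    simp only [dotProduct, Matrix.mulVec, hsymm, Matrix.sub_apply, mul_sub,
      Finset.sum_sub_distrib, Matrix.one_apply]
    simp [mul_comm]
  have hUv : (U * U.transpose).mulVec v i = σ * ((fun j => (U * U.transpose * N) i j) ⬝ᵥ z) := by
    rw [hvz, Matrix.mulVec_mulVec, Matrix.mul_assoc, hUY, Matrix.mul_smul, Matrix.smul_mulVec,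
      Pi.smul_apply, smul_eq_mul, Matrix.mul_assoc]
    rfl
  have hzv : σ * c * √(∑ j, z j ^ 2) ≤ √(∑ j, v j ^ 2) := by
    apply Real.le_sqrt_of_sq_le
    rw [mul_pow, mul_pow, Real.sq_sqrt (Finset.sum_nonneg fun _ _ => sq_nonneg _), hvz]
    exact hYx z
  set nv := √(∑ j, v j ^ 2) with hnv
  have hnv0 : 0 ≤ nv := Real.sqrt_nonneg _
  have hnv2 : nv ^ 2 = v i := by
    rw [hnv, Real.sq_sqrt (Finset.sum_nonneg fun _ _ => sq_nonneg _), hvv]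
  have h1 : v ⬝ᵥ (fun j => ((1 : Matrix (Fin m) (Fin m) ℝ) - U * U.transpose) j i) ≤ nv * κ :=
    (dotProduct_le_sqrt_mul_sqrt _ _).trans
      (mul_le_mul_of_nonneg_left ((Real.sqrt_le_left hκ).2 (hκU i)) hnv0)
  have h2 : σ * ((fun j => (U * U.transpose * N) i j) ⬝ᵥ z) ≤ nv * (τ / c) := by
    have h3 : (fun j => (U * U.transpose * N) i j) ⬝ᵥ z ≤ τ * √(∑ j, z j ^ 2) :=
      (dotProduct_le_sqrt_mul_sqrt _ _).trans
        (mul_le_mul_of_nonneg_right ((Real.sqrt_le_left hτ).2 (hτN i)) (Real.sqrt_nonneg _))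
    calc σ * ((fun j => (U * U.transpose * N) i j) ⬝ᵥ z) ≤ σ * (τ * √(∑ j, z j ^ 2)) := by gcongr
      _ = (σ * c * √(∑ j, z j ^ 2)) * (τ / c) := by field_simp
      _ ≤ nv * (τ / c) := by gcongr
  have h4 : nv * nv ≤ nv * (κ + τ / c) := by
    rw [← pow_two, hnv2, hvi, hUv, mul_add]
    exact add_le_add h1 h2
  rcases hnv0.eq_or_lt with h0 | hpos
  · rw [← h0]
    positivity
  · exact le_of_mul_le_mul_left h4 hpos

end LinearAlgebra

/-! ### Error of the mechanism -/

section Utility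

variable {m n l k d q : ℕ}

theorem rank_add_le (A B : Matrix (Fin m) (Fin n) ℝ) : (A + B).rank ≤ A.rank + B.rank := by
  rw [Matrix.rank, Matrix.rank, Matrix.rank, Matrix.mulVecLin_add]
  refine (Submodule.finrank_mono (t := LinearMap.range A.mulVecLin ⊔ LinearMap.range B.mulVecLin)
    ?_).trans (Submodule.finrank_add_le_finrank_add_finrank _ _)
  rintro _ ⟨x, rfl⟩
  exact Submodule.add_mem_sup ⟨x, rfl⟩ ⟨x, rfl⟩

/-- If `rank X ≤ k ≤ rank A`, some matrix of rank exactly `k` is at least as close to `A` as `X`: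
replace the columns of `X` by those of `A` one after the other, so that the rank changes by at most
one in each step. -/
theorem exists_rank_eq_frobNorm_le {A X : Matrix (Fin m) (Fin n) ℝ} (hX : X.rank ≤ k)
    (hA : k ≤ A.rank) :
    ∃ X' : Matrix (Fin m) (Fin n) ℝ, X'.rank = k ∧ frobNorm (A - X') ≤ frobNorm (A - X) := by
  classical
  let Z : ℕ → Matrix (Fin m) (Fin n) ℝ := fun t =>
    Matrix.of fun i j => if (j : ℕ) < t then A i j else X i j
  have hZn : Z n = A := by
    ext i j
    simp [Z]
  have hZ0 : Z 0 = X := by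
    ext i j
    simp [Z]
  have hex : ∃ t, k ≤ (Z t).rank := ⟨n, by rwa [hZn]⟩
  have hstep : ∀ t, (Z (t + 1)).rank ≤ (Z t).rank + 1 := by
    intro t
    by_cases ht : t < n
    · have h1 : Z (t + 1) = Z t + Matrix.vecMulVec (fun i => A i ⟨t, ht⟩ - X i ⟨t, ht⟩)
          (Pi.single ⟨t, ht⟩ 1) := by
        ext i j
        rw [Matrix.add_apply, Matrix.vecMulVec_apply]
        by_cases hj : j = ⟨t, ht⟩
        · subst hj
          simp [Z]
        · have hj' : (j : ℕ) ≠ t := fun h => hj (Fin.ext h)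
          have h2 : (j : ℕ) < t + 1 ↔ (j : ℕ) < t := by omega
          simp [Z, hj, h2]
      rw [h1]
      exact (rank_add_le _ _).trans (Nat.add_le_add_left (Matrix.rank_vecMulVec_le _ _) _)
    · have h1 : Z (t + 1) = Z t := by
        ext i j
        have h2 : (j : ℕ) < t := by omega
        have h3 : (j : ℕ) < t + 1 := by omega
        simp [Z, h2, h3]
      rw [h1]
      exact Nat.le_succ _
  refine ⟨Z (Nat.find hex), le_antisymm ?_ (Nat.find_spec hex), ?_⟩
  · rcases h : Nat.find hex with _ | t
    · rwa [hZ0]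
    · have h1 := Nat.find_min hex (m := t) (by omega)
      have h2 := hstep t
      omega
  · refine (sq_le_sq₀ (frobNorm_nonneg _) (frobNorm_nonneg _)).1 ?_
    rw [frobNorm_sq, frobNorm_sq]
    refine Finset.sum_le_sum fun i _ => Finset.sum_le_sum fun j _ => ?_
    rw [Matrix.sub_apply, Matrix.sub_apply]
    by_cases h : (j : ℕ) < Nat.find hex
    · simp only [Z, Matrix.of_apply, h, if_true, sub_self]
      rw [zero_pow two_ne_zero]
      exact sq_nonneg _
    · simp only [Z, Matrix.of_apply, h, if_false]
      exact le_rfl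

/-- The sketch is well conditioned on a subspace with orthonormal basis `V`. -/
theorem gaussianMatrix_sketch_ge {V : Matrix (Fin n) (Fin d) ℝ} (hV : V.transpose * V = 1)
    (hl : 4 * ((d : ℝ) * Real.log (161 * d) + 5) ≤ l) :
    gaussianMatrix n l {Ω | ¬ ∀ x : Fin d → ℝ, (l : ℝ) / 64 * ∑ j, x j ^ 2 ≤
      ∑ i, ((V.transpose * Ω).transpose.mulVec x) i ^ 2} ≤ ENNReal.ofReal (2 / 100) := by
  refine le_trans ?_ (gaussianMatrix_sum_mulVec_sq_ge hl)
  have h1 : Measurable fun Ω : Matrix (Fin n) (Fin l) ℝ => V.transpose * Ω :=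
    measurable_matrix_mul measurable_const measurable_id
  have h2 : Measurable (Matrix.transpose : Matrix (Fin d) (Fin l) ℝ → _) :=
    measurable_matrix_transpose measurable_id
  rw [← gaussianMatrix_map_transpose (a := d) (b := l), ← gaussianMatrix_map_transpose_mul hV,
    Measure.map_map h2 h1]
  exact Measure.le_map_apply (h2.comp h1).aemeasurable _

/-- The noise is well conditioned on a subspace with orthonormal basis `U`. -/
theorem gaussianMatrix_noise_ge {U : Matrix (Fin m) (Fin q) ℝ} (hU : U.transpose * U = 1)
    (hq : 4 * ((l : ℝ) * Real.log (161 * l) + 5) ≤ q) :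
    gaussianMatrix m l {N | ¬ ∀ x : Fin l → ℝ, (q : ℝ) / 64 * ∑ j, x j ^ 2 ≤
      ∑ i, ((U.transpose * N).mulVec x) i ^ 2} ≤ ENNReal.ofReal (2 / 100) := by
  refine le_trans ?_ (gaussianMatrix_sum_mulVec_sq_ge hq)
  have h1 : Measurable fun N : Matrix (Fin m) (Fin l) ℝ => U.transpose * N :=
    measurable_matrix_mul measurable_const measurable_id
  rw [← gaussianMatrix_map_transpose_mul hU]
  exact Measure.le_map_apply h1.aemeasurable _

/-- The rows of a projected Gaussian matrix are short. -/
theorem gaussianMatrix_rows_tail (hm : 0 < m) {U : Matrix (Fin m) (Fin q) ℝ}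
    (hU : U.transpose * U = 1) :
    gaussianMatrix m l {N | ¬ ∀ i, ∑ j, (U * U.transpose * N) i j ^ 2 ≤
      4 * (l + Real.log (100 * m))} ≤ ENNReal.ofReal (1 / 100) := by
  set Q := U * U.transpose with hQ
  have hQQ : ∀ i, ∑ j, Q i j ^ 2 = Q i i := by
    intro i
    have h1 : Q * Q.transpose = Q := by
      calc Q * Q.transpose = U * (U.transpose * U) * U.transpose := by
            simp only [hQ, Matrix.transpose_mul, Matrix.transpose_transpose, Matrix.mul_assoc]
        _ = Q := by rw [hU, Matrix.mul_one]
    have h2 := congrFun (congrFun h1 i) i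
    simpa [Matrix.mul_apply, pow_two] using h2
  have hQ1 : ∀ i, ∑ j, Q i j ^ 2 ≤ 1 := by
    intro i
    have h1 : Q i i ^ 2 ≤ Q i i := by
      nth_rw 2 [← hQQ i]
      exact Finset.single_le_sum (f := fun j => Q i j ^ 2) (fun _ _ => sq_nonneg _)
        (Finset.mem_univ i)
    rw [hQQ]
    nlinarith
  have hsub : {N : Matrix (Fin m) (Fin l) ℝ | ¬ ∀ i, ∑ j, (Q * N) i j ^ 2 ≤
      4 * (l + Real.log (100 * m))} ⊆
      ⋃ i : Fin m, {N | 4 * (l + Real.log (100 * m)) ≤ ∑ j, (Matrix.vecMul (Q i) N) j ^ 2} := by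
    intro N hN
    simp only [Set.mem_ofPred_eq, not_forall, not_le] at hN
    obtain ⟨i, hi⟩ := hN
    exact Set.mem_iUnion.2 ⟨i, hi.le⟩
  refine (measure_mono hsub).trans ((measure_iUnion_fintype_le _ _).trans ?_)
  refine (Finset.sum_le_sum fun i _ => gaussianMatrix_sum_vecMul_sq_tail (hQ1 i) _).trans ?_
  have hm' : (0 : ℝ) < m := by exact_mod_cast hm
  rw [Finset.sum_const, Finset.card_univ, Fintype.card_fin, nsmul_eq_mul, Real.exp_neg,
    Real.exp_log (by positivity), ← ENNReal.ofReal_natCast, ← ENNReal.ofReal_mul (by positivity)]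
  apply ENNReal.ofReal_le_ofReal
  apply le_of_eq
  field_simp

/-- The error of the projection, on the event where all noise matrices behave typically. -/
theorem frobNorm_sub_noisyProj_le {σ ρ κ : ℝ} (hσ : 0 < σ) (hρ : 0 < ρ) (hκ : 0 ≤ κ)
    (hl : 0 < l) (hq : 0 < q)
    {A X : Matrix (Fin m) (Fin n) ℝ} {V : Matrix (Fin n) (Fin d) ℝ} (hV : V.transpose * V = 1)
    (hXV : X * (V * V.transpose) = X) {U : Matrix (Fin m) (Fin q) ℝ}
    (hU : U.transpose * U = 1) (hUA : U.transpose * A = 0)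
    (hκU : ∀ i, ∑ j, ((1 : Matrix (Fin m) (Fin m) ℝ) - U * U.transpose) j i ^ 2 ≤ κ ^ 2)
    {Ω : Matrix (Fin n) (Fin l) ℝ} {N : Matrix (Fin m) (Fin l) ℝ} {N' : Matrix (Fin m) (Fin n) ℝ}
    (h1 : ∀ x : Fin d → ℝ, (l : ℝ) / 64 * ∑ j, x j ^ 2 ≤
      ∑ i, ((V.transpose * Ω).transpose.mulVec x) i ^ 2)
    (h2 : frobNorm ((A - X) * Ω) ^ 2 ≤ 100 * (l * frobNorm (A - X) ^ 2))
    (h3 : ∀ x : Fin l → ℝ, (q : ℝ) / 64 * ∑ j, x j ^ 2 ≤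
      ∑ i, ((U.transpose * N).mulVec x) i ^ 2)
    (h4 : frobNorm N ^ 2 ≤ 100 * ((m : ℝ) * l))
    {T : ℝ} (hT : 0 ≤ T) (h5 : ∀ i, ∑ j, (U * U.transpose * N) i j ^ 2 ≤ T)
    (h6 : frobNorm (colProj (sketch σ A Ω N) * N') ^ 2 ≤
      100 * (n * frobNorm (colProj (sketch σ A Ω N)) ^ 2)) :
    frobNorm (A - noisyProj ρ A (sketch σ A Ω N) N') ≤
      81 * frobNorm (A - X) + 80 * σ * √m +
        (κ + √T / (√q / 8)) / ρ * (10 * √(l * n)) := by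
  set Y := sketch σ A Ω N with hY
  have hc1 : (√(l : ℝ) / 8) ^ 2 = (l : ℝ) / 64 := by
    rw [div_pow, Real.sq_sqrt (by positivity)]; norm_num
  have hc2 : (√(q : ℝ) / 8) ^ 2 = (q : ℝ) / 64 := by
    rw [div_pow, Real.sq_sqrt (by positivity)]; norm_num
  have hl' : (0 : ℝ) < l := by exact_mod_cast hl
  have hq' : (0 : ℝ) < q := by exact_mod_cast hq
  have hsl : 0 < √(l : ℝ) := Real.sqrt_pos.2 hl'
  obtain ⟨hunit, hwidth⟩ := colProjWidth_sketch_le hσ (c := √q / 8) (by positivity) hκ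
    (Real.sqrt_nonneg T) A Ω N hU hUA (by rw [hc2]; exact h3) hκU
    (by rw [Real.sq_sqrt hT]; exact h5)
  have hrange := frobNorm_sub_colProj_sketch_le hσ (c := √l / 8) (by positivity) A X Ω N hunit hV
    hXV (by rw [hc1]; exact h1)
  have h2' : frobNorm ((A - X) * Ω) ≤ 10 * √l * frobNorm (A - X) := by
    refine (sq_le_sq₀ (frobNorm_nonneg _) (mul_nonneg (by positivity) (frobNorm_nonneg _))).1 ?_
    rw [mul_pow, mul_pow, Real.sq_sqrt hl'.le]
    linarith
  have h4' : frobNorm N ≤ 10 * √m * √l := by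
    refine (sq_le_sq₀ (frobNorm_nonneg _) (by positivity)).1 ?_
    rw [mul_pow, mul_pow, Real.sq_sqrt hl'.le, Real.sq_sqrt (by positivity)]
    linarith
  have h6' : frobNorm (colProj Y * N') ≤ 10 * √(l * n) := by
    refine (sq_le_sq₀ (frobNorm_nonneg _) (by positivity)).1 ?_
    rw [mul_pow, Real.sq_sqrt (by positivity)]
    have h7 := mul_le_mul_of_nonneg_left (frobNorm_colProj_sq_le Y) (Nat.cast_nonneg (α := ℝ) n)
    linarith
  have hproj : frobNorm (A - colProj Y * A) ≤ 81 * frobNorm (A - X) + 80 * σ * √m := by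
    have h7 : √l / 8 * frobNorm (A - colProj Y * A) ≤
        √l / 8 * (81 * frobNorm (A - X) + 80 * σ * √m) := by
      have h8 : σ * frobNorm N ≤ σ * (10 * √m * √l) := by gcongr
      linarith
    exact le_of_mul_le_mul_left h7 (by positivity)
  have hdecomp : A - noisyProj ρ A Y N' =
      (A - colProj Y * A) - (colProjWidth Y / ρ) • (colProj Y * N') := by
    rw [noisyProj, Matrix.mul_add, Matrix.mul_smul]
    abel
  rw [hdecomp]
  refine (frobNorm_sub_le _ _).trans (add_le_add hproj ?_)
  rw [frobNorm_smul, abs_of_nonneg (div_nonneg (colProjWidth_nonneg _) hρ.le)]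
  exact mul_le_mul (div_le_div_of_nonneg_right hwidth hρ.le) h6' (frobNorm_nonneg _)
    (by positivity)

/-- With high probability, the projection has a small error. -/
theorem noiseLaw_frobNorm_sub_noisyProj {σ ρ κ : ℝ} (hσ : 0 < σ) (hρ : 0 < ρ) (hκ : 0 ≤ κ)
    (hm : 0 < m) (A X : Matrix (Fin m) (Fin n) ℝ)
    (hl : 4 * ((X.rank : ℝ) * Real.log (161 * X.rank) + 5) ≤ l)
    (hmq : 4 * ((l : ℝ) * Real.log (161 * l) + 5) ≤ (m : ℝ) - A.rank)
    (hκA : ∀ i, ‖(colSpace A).starProjection (EuclideanSpace.single i (1 : ℝ))‖ ^ 2 ≤ κ ^ 2) :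
    noiseLaw m n l {ω | ¬ frobNorm (A - noisyProj ρ A (sketch σ A ω.1 ω.2.1) ω.2.2) ≤
      81 * frobNorm (A - X) + 80 * σ * √m +
        (κ + √(4 * (l + Real.log (100 * m))) / (√(m - A.rank) / 8)) / ρ * (10 * √(l * n))} ≤
      ENNReal.ofReal (1 / 10) := by
  obtain ⟨d, V, hd, hV, hXV⟩ := exists_orthonormal_rowSpace X
  obtain ⟨q, U, hqm, hU, hUA, hκU⟩ := exists_orthonormal_colSpace_compl A
  have hq : (m : ℝ) - A.rank = q := by
    have h : (q : ℝ) + A.rank = m := by exact_mod_cast hqm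
    linarith
  rw [← hd] at hl
  rw [hq] at hmq ⊢
  have hlog : ∀ t : ℕ, 0 ≤ (t : ℝ) * Real.log (161 * t) := fun t => by
    rcases Nat.eq_zero_or_pos t with rfl | ht
    · simp
    · have : (1 : ℝ) ≤ t := by exact_mod_cast ht
      exact mul_nonneg (by positivity) (Real.log_nonneg (by linarith))
  have hl0 : 0 < l := by
    have h := hlog d
    have : (0 : ℝ) < l := by linarith
    exact_mod_cast this
  have hq0 : 0 < q := by
    have h := hlog l
    have : (0 : ℝ) < q := by linarith
    exact_mod_cast this
  have hT : 0 ≤ 4 * ((l : ℝ) + Real.log (100 * m)) := by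
    have : (1 : ℝ) ≤ m := by exact_mod_cast hm
    have := Real.log_nonneg (by linarith : (1 : ℝ) ≤ 100 * m)
    positivity
  set B1 : Set (Matrix (Fin n) (Fin l) ℝ) := {Ω | ¬ ∀ x : Fin d → ℝ,
    (l : ℝ) / 64 * ∑ j, x j ^ 2 ≤ ∑ i, ((V.transpose * Ω).transpose.mulVec x) i ^ 2} with hB1
  set B2 : Set (Matrix (Fin n) (Fin l) ℝ) :=
    {Ω | 100 * (l * frobNorm (A - X) ^ 2) < frobNorm ((A - X) * Ω) ^ 2} with hB2
  set B3 : Set (Matrix (Fin m) (Fin l) ℝ) := {N | ¬ ∀ x : Fin l → ℝ,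
    (q : ℝ) / 64 * ∑ j, x j ^ 2 ≤ ∑ i, ((U.transpose * N).mulVec x) i ^ 2} with hB3
  set B4 : Set (Matrix (Fin m) (Fin l) ℝ) := {N | 100 * ((m : ℝ) * l) < frobNorm N ^ 2} with hB4
  set B5 : Set (Matrix (Fin m) (Fin l) ℝ) := {N | ¬ ∀ i, ∑ j, (U * U.transpose * N) i j ^ 2 ≤
      4 * (l + Real.log (100 * m))} with hB5
  set B6 : Set (Matrix (Fin n) (Fin l) ℝ × Matrix (Fin m) (Fin l) ℝ × Matrix (Fin m) (Fin n) ℝ) :=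
    {ω | 100 * (n * frobNorm (colProj (sketch σ A ω.1 ω.2.1)) ^ 2) <
      frobNorm (colProj (sketch σ A ω.1 ω.2.1) * ω.2.2) ^ 2} with hB6
  have hsub : {ω : Matrix (Fin n) (Fin l) ℝ × Matrix (Fin m) (Fin l) ℝ × Matrix (Fin m) (Fin n) ℝ |
      ¬ frobNorm (A - noisyProj ρ A (sketch σ A ω.1 ω.2.1) ω.2.2) ≤
      81 * frobNorm (A - X) + 80 * σ * √m +
        (κ + √(4 * (l + Real.log (100 * m))) / (√q / 8)) / ρ * (10 * √(l * n))} ⊆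
      (B1 ∪ B2) ×ˢ Set.univ ∪ (Set.univ ×ˢ ((B3 ∪ B4 ∪ B5) ×ˢ Set.univ) ∪ B6) := by
    intro ω hω
    by_contra hcon
    simp only [Set.mem_union, Set.mem_prod, Set.mem_univ, and_true, true_and, not_or] at hcon
    obtain ⟨⟨h1, h2⟩, ⟨⟨h3, h4⟩, h5⟩, h6⟩ := hcon
    exact hω (frobNorm_sub_noisyProj_le hσ hρ hκ hl0 hq0 hV hXV hU hUA
      (fun i => (hκU i).trans_le (hκA i)) (not_not.1 h1) (not_lt.1 h2) (not_not.1 h3)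
      (not_lt.1 h4) hT (not_not.1 h5) (not_lt.1 h6))
  have hP6 : noiseLaw m n l B6 ≤ ENNReal.ofReal (1 / 100) := by
    have hs : Measurable fun ω : Matrix (Fin n) (Fin l) ℝ × Matrix (Fin m) (Fin l) ℝ ×
        Matrix (Fin m) (Fin n) ℝ => colProj (sketch σ A ω.1 ω.2.1) :=
      measurable_colProj (measurable_sketch σ measurable_const (by fun_prop) (by fun_prop))
    have hmeas : MeasurableSet B6 :=
      measurableSet_lt ((((measurable_frobNorm hs).pow_const 2).const_mul _).const_mul _)
        ((measurable_frobNorm (measurable_matrix_mul hs (by fun_prop))).pow_const 2)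
    rw [noiseLaw, Measure.prod_apply hmeas]
    refine (lintegral_mono (g := fun _ => ENNReal.ofReal (1 / 100)) fun Ω => ?_).trans (by simp)
    have hmeas' := measurable_prodMk_left (x := Ω) hmeas
    beta_reduce
    rw [Measure.prod_apply hmeas']
    exact (lintegral_mono (g := fun _ => ENNReal.ofReal (1 / 100)) fun N =>
      gaussianMatrix_frobNorm_mul_tail (colProj (sketch σ A Ω N))).trans (by simp)
  have hP12 : noiseLaw m n l ((B1 ∪ B2) ×ˢ Set.univ) ≤
      ENNReal.ofReal (2 / 100) + ENNReal.ofReal (1 / 100) := by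
    rw [noiseLaw, Measure.prod_prod, measure_univ, mul_one]
    exact (measure_union_le _ _).trans
      (add_le_add (gaussianMatrix_sketch_ge hV hl) (gaussianMatrix_frobNorm_mul_tail _))
  have hP345 : noiseLaw m n l (Set.univ ×ˢ ((B3 ∪ B4 ∪ B5) ×ˢ Set.univ)) ≤
      ENNReal.ofReal (2 / 100) + ENNReal.ofReal (1 / 100) + ENNReal.ofReal (1 / 100) := by
    rw [noiseLaw, Measure.prod_prod, Measure.prod_prod, measure_univ, measure_univ, mul_one,
      one_mul]
    exact (measure_union_le _ _).trans (add_le_add ((measure_union_le _ _).trans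
      (add_le_add (gaussianMatrix_noise_ge hU hmq) gaussianMatrix_frobNorm_tail))
      (gaussianMatrix_rows_tail hm hU))
  refine (measure_mono hsub).trans ((measure_union_le _ _).trans ((add_le_add hP12
    ((measure_union_le _ _).trans (add_le_add hP345 hP6))).trans ?_))
  rw [← ENNReal.ofReal_add (by norm_num) (by norm_num),
    ← ENNReal.ofReal_add (by norm_num) (by norm_num),
    ← ENNReal.ofReal_add (by norm_num) (by norm_num),
    ← ENNReal.ofReal_add (by norm_num) (by norm_num)]
  apply ENNReal.ofReal_le_ofReal
  norm_num

theorem mechanism_ae_rank_eq {σ ρ : ℝ} {A X : Matrix (Fin m) (Fin n) ℝ} (hX : X.rank = k) :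
    ∀ᵐ B ∂(mechanism m n l k σ ρ A), B.rank = k := by
  have hspec := (exists_measurable_rank_eq m n k).choose_spec
  have hmo : Measurable fun ω : Matrix (Fin n) (Fin l) ℝ × Matrix (Fin m) (Fin l) ℝ ×
      Matrix (Fin m) (Fin n) ℝ => outputMap k σ ρ (A, ω) :=
    (measurable_outputMap k σ ρ).comp (by fun_prop)
  have : MeasurableSingletonClass (Matrix (Fin m) (Fin n) ℝ) :=
    inferInstanceAs (MeasurableSingletonClass (Fin m → Fin n → ℝ))
  rw [mechanism_apply]
  have h : ∀ᵐ B ∂((noiseLaw m n l).map fun ω => outputMap k σ ρ (A, ω)),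
      B ∈ Set.range (roundRank m n k) := by
    rw [ae_map_iff hmo.aemeasurable (p := (· ∈ Set.range (roundRank m n k)))
      hspec.2.1.measurableSet]
    exact ae_of_all _ fun ω => ⟨_, rfl⟩
  filter_upwards [h] with B hB
  obtain ⟨B', rfl⟩ := hB
  exact (hspec.2.2 X hX B').1

/-- The error of the output, in terms of a comparison matrix `X` of rank `k`. -/
theorem mechanism_error {σ ρ κ t : ℝ} (hσ : 0 < σ) (hρ : 0 < ρ) (hκ : 0 ≤ κ)
    (hm : 0 < m) (A X : Matrix (Fin m) (Fin n) ℝ) (hX : X.rank = k)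
    (hl : 4 * ((k : ℝ) * Real.log (161 * k) + 5) ≤ l)
    (hmq : 4 * ((l : ℝ) * Real.log (161 * l) + 5) ≤ (m : ℝ) - A.rank)
    (hκA : ∀ i, ‖(colSpace A).starProjection (EuclideanSpace.single i (1 : ℝ))‖ ^ 2 ≤ κ ^ 2)
    (ht : 2 * (81 * frobNorm (A - X) + 80 * σ * √m +
        (κ + √(4 * (l + Real.log (100 * m))) / (√(m - A.rank) / 8)) / ρ * (10 * √(l * n))) +
        frobNorm (A - X) + 1 ≤ t) :
    9 / 10 ≤ (mechanism m n l k σ ρ A).real {B | frobNorm (A - B) ≤ t} := by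
  have hmo : Measurable fun ω : Matrix (Fin n) (Fin l) ℝ × Matrix (Fin m) (Fin l) ℝ ×
      Matrix (Fin m) (Fin n) ℝ => outputMap k σ ρ (A, ω) :=
    (measurable_outputMap k σ ρ).comp (by fun_prop)
  have hS : MeasurableSet {B : Matrix (Fin m) (Fin n) ℝ | frobNorm (A - B) ≤ t} :=
    measurableSet_le (measurable_frobNorm (measurable_matrix_sub measurable_const measurable_id))
      measurable_const
  have hbad : (mechanism m n l k σ ρ A) {B | frobNorm (A - B) ≤ t}ᶜ ≤ ENNReal.ofReal (1 / 10) := by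
    rw [mechanism_apply, Measure.map_apply hmo hS.compl]
    rw [← hX] at hl
    refine (measure_mono ?_).trans (noiseLaw_frobNorm_sub_noisyProj hσ hρ hκ hm A X hl hmq hκA)
    intro ω hω hle
    refine hω ?_
    set B := noisyProj ρ A (sketch σ A ω.1 ω.2.1) ω.2.2
    have h1 := ((exists_measurable_rank_eq m n k).choose_spec.2.2 X hX B).2
    have h2 : frobNorm (A - roundRank m n k B) ≤
        frobNorm (A - B) + frobNorm (B - roundRank m n k B) := by
      rw [← sub_add_sub_cancel A B (roundRank m n k B)]
      exact frobNorm_add_le _ _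
    have h3 : frobNorm (B - X) ≤ frobNorm (A - B) + frobNorm (A - X) := by
      rw [frobNorm_sub_comm A B, ← sub_add_sub_cancel B A X]
      exact frobNorm_add_le _ _
    change frobNorm (A - roundRank m n k B) ≤ t
    change frobNorm (B - roundRank m n k B) ≤ _ at h1
    linarith
  have h1 : (mechanism m n l k σ ρ A).real {B | frobNorm (A - B) ≤ t}ᶜ ≤ 1 / 10 :=
    ENNReal.toReal_le_of_le_ofReal (by norm_num) hbad
  rw [probReal_compl_eq_one_sub hS] at h1
  linarith

end Utility

/-! ### Choice of the parameters -/

section Parameters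

/-- The number of columns of the sketch, of order `k log k`. -/
def sketchSize (k : ℕ) : ℕ := 16 * k * (Nat.log 2 k + 1)

/-- The largest admissible ratio of sensitivity to noise level in each of the two phases. -/
noncomputable def noiseRatio (ε δ : ℝ) : ℝ := ε / 2 / √(8 * Real.log (4 / δ))

/-- The noise level of the sketch. -/
noncomputable def sketchNoise (k : ℕ) (ε δ : ℝ) : ℝ :=
  2 * √(sketchSize k + Real.log (4 / δ)) / noiseRatio ε δ

/-- The private low-rank approximation algorithm. -/
noncomputable def algorithm : Algorithm := fun m n r p ε δ =>
  mechanism m n (sketchSize (r + p)) (r + p) (sketchNoise (r + p) ε δ) (noiseRatio ε δ)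

theorem one_le_log_four_div {δ : ℝ} (hδ : 0 < δ) (hδ1 : δ < 1) : 1 ≤ Real.log (4 / δ) := by
  rw [Real.le_log_iff_exp_le (by positivity), le_div_iff₀ hδ]
  nlinarith [Real.exp_one_lt_three, Real.exp_pos 1]

theorem noiseRatio_pos {ε δ : ℝ} (hε : 0 < ε) (hδ : 0 < δ) (hδ1 : δ < 1) :
    0 < noiseRatio ε δ := by
  have := one_le_log_four_div hδ hδ1
  unfold noiseRatio
  positivity

theorem sketchNoise_pos (k : ℕ) {ε δ : ℝ} (hε : 0 < ε) (hδ : 0 < δ) (hδ1 : δ < 1) :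
    0 < sketchNoise k ε δ := by
  have := one_le_log_four_div hδ hδ1
  have := noiseRatio_pos hε hδ hδ1
  unfold sketchNoise
  positivity

theorem algorithm_isDP (m n r p : ℕ) {ε δ : ℝ} (hε : 0 < ε) (hε1 : ε < 1) (hδ : 0 < δ)
    (hδ1 : δ < 1) : IsDP ε δ (algorithm m n r p ε δ) := by
  have h1 := one_le_log_four_div hδ hδ1
  have h2 := noiseRatio_pos hε hδ hδ1
  refine mechanism_isDP _ hε hε1 hδ hδ1 h2 ?_ (sketchNoise_pos _ hε hδ hδ1) ?_
  · rw [noiseRatio, div_pow, Real.sq_sqrt (by positivity)]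
    field_simp
  · rw [sketchNoise, div_mul_cancel₀ _ h2.ne', mul_pow, Real.sq_sqrt (by positivity)]
    norm_num

theorem two_mul_log_two_le_log {k : ℕ} (hk : 4 ≤ k) : 2 * Real.log 2 ≤ Real.log k := by
  have h : (4 : ℝ) ≤ k := by exact_mod_cast hk
  have h2 := Real.log_le_log (by norm_num) h
  have h3 : Real.log 4 = 2 * Real.log 2 := by
    rw [show (4 : ℝ) = 2 ^ 2 by norm_num, Real.log_pow]
    norm_num
  linarith

theorem one_le_log {k : ℕ} (hk : 4 ≤ k) : 1 ≤ Real.log k := by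
  have := two_mul_log_two_le_log hk
  linarith [Real.log_two_gt_d9]

theorem sketchSize_le {k : ℕ} (hk : 4 ≤ k) : (sketchSize k : ℝ) ≤ 48 * (k * Real.log k) := by
  have h1 := one_le_log hk
  have h2 : (Nat.log 2 k : ℝ) * Real.log 2 ≤ Real.log k := by
    rw [← Real.log_pow]
    apply Real.log_le_log (by positivity)
    exact_mod_cast Nat.pow_log_le_self 2 (by omega)
  have h3 : (Nat.log 2 k : ℝ) + 1 ≤ 3 * Real.log k := by
    have h0 : (0 : ℝ) ≤ Nat.log 2 k := by positivity
    nlinarith [Real.log_two_gt_d9]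
  rw [sketchSize]
  push_cast
  calc 16 * (k : ℝ) * ((Nat.log 2 k : ℝ) + 1) ≤ 16 * k * (3 * Real.log k) := by gcongr
    _ = _ := by ring

/-- The sketch is large enough to be well conditioned on every `k`-dimensional subspace. -/
theorem le_sketchSize {k : ℕ} (hk : 4 ≤ k) :
    4 * ((k : ℝ) * Real.log (161 * k) + 5) ≤ sketchSize k := by
  have hk' : (4 : ℝ) ≤ k := by exact_mod_cast hk
  have h1 : Real.log k ≤ (Nat.log 2 k : ℝ) + 1 := by
    have h2 : (k : ℝ) ≤ 2 ^ (Nat.log 2 k + 1) := by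
      exact_mod_cast (Nat.lt_pow_succ_log_self (by norm_num) k).le
    have h3 := Real.log_le_log (by linarith) h2
    rw [Real.log_pow] at h3
    push_cast at h3
    have h0 : (0 : ℝ) ≤ Nat.log 2 k := by positivity
    nlinarith [Real.log_two_lt_d9]
  have h2 : (3 : ℝ) ≤ (Nat.log 2 k : ℝ) + 1 := by
    have : 2 ≤ Nat.log 2 k := Nat.le_log_of_pow_le (by norm_num) (by omega)
    have : (2 : ℝ) ≤ Nat.log 2 k := by exact_mod_cast this
    linarith
  have h3 : Real.log 161 ≤ 6 := by
    have h4 := Real.log_le_log (by norm_num) (by norm_num : (161 : ℝ) ≤ 2 ^ 8)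
    rw [Real.log_pow] at h4
    norm_num at h4
    linarith [Real.log_two_lt_d9]
  rw [Real.log_mul (by norm_num) (by positivity), sketchSize]
  push_cast
  nlinarith

/-- The dimension needed for `sketchSize k` Gaussian columns to be well conditioned is of order
`k (log k)² ≤ k² log k`. -/
theorem four_mul_sketchSize_mul_log_le {k : ℕ} (hk : 4 ≤ k) :
    4 * ((sketchSize k : ℝ) * Real.log (161 * sketchSize k) + 5) ≤
      1640 * ((k : ℝ) * k * Real.log k) := by
  have hk' : (4 : ℝ) ≤ k := by exact_mod_cast hk
  have h1 := one_le_log hk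
  have h2 := sketchSize_le hk
  have h3 : Real.log k ≤ k := (Real.log_le_sub_one_of_pos (by linarith)).trans (by linarith)
  have hpos : (0 : ℝ) < sketchSize k := by
    have : 0 < sketchSize k := by unfold sketchSize; positivity
    exact_mod_cast this
  have h4 : Real.log (161 * sketchSize k) ≤ 8.5 * Real.log k := by
    have h5 : 161 * (sketchSize k : ℝ) ≤ 2 ^ 13 * k ^ 2 := by
      have : (k : ℝ) * Real.log k ≤ k * k := by gcongr
      nlinarith
    have h6 := Real.log_le_log (by positivity) h5
    rw [Real.log_mul (x := 2 ^ 13) (by positivity) (by positivity), Real.log_pow,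
      Real.log_pow] at h6
    push_cast at h6
    linarith [two_mul_log_two_le_log hk]
  have h7 : (sketchSize k : ℝ) * Real.log (161 * sketchSize k) ≤
      48 * (k * Real.log k) * (8.5 * Real.log k) := by
    refine mul_le_mul h2 h4 ?_ (by positivity)
    apply Real.log_nonneg
    have : (1 : ℝ) ≤ sketchSize k := by exact_mod_cast Nat.one_le_iff_ne_zero.2 (by
      intro h; rw [h] at hpos; simp at hpos)
    linarith
  have h8 : (k : ℝ) * Real.log k * Real.log k ≤ k * Real.log k * k := by gcongr
  have h9 : (16 : ℝ) ≤ k * k * Real.log k := by nlinarith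
  nlinarith

end Parameters

/-! ### Bounds for an instance -/

namespace Instance

variable (I : Instance)

theorem four_le_k : 4 ≤ I.k := Nat.add_le_add I.two_le_r I.two_le_p

theorem k_le_R : I.k ≤ I.R := I.le_rank

theorem R_le_m : I.R ≤ I.m := I.A.rank_le_height

theorem log_k_le_L : Real.log I.k ≤ I.L := by
  have hk : (4 : ℝ) ≤ I.k := by exact_mod_cast I.four_le_k
  apply Real.log_le_log (by linarith)
  rw [le_div_iff₀ I.δ_pos]
  nlinarith [I.δ_lt_one]

theorem log_four_div_le_L : Real.log (4 / I.δ) ≤ I.L := by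
  have hk : (4 : ℝ) ≤ I.k := by exact_mod_cast I.four_le_k
  have := I.δ_pos
  exact Real.log_le_log (by positivity) (by gcongr)

theorem one_le_L : 1 ≤ I.L := (one_le_log I.four_le_k).trans I.log_k_le_L

theorem mu0_nonneg : 0 ≤ mu0 I.A :=
  mul_nonneg (by positivity) (Real.iSup_nonneg fun _ => sq_nonneg _)

/-- A matrix of rank `k` that is essentially as close to `A` as the best one of rank at most `r`.
The slack of one avoids showing that the best one exists, and is dominated by the noise term. -/
theorem exists_rank_eq :
    ∃ X : Matrix (Fin I.m) (Fin I.n) ℝ, X.rank = I.k ∧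
      frobNorm (I.A - X) ≤ bestRankError I.A I.r + 1 := by
  have hne : {d : ℝ | ∃ X : Matrix (Fin I.m) (Fin I.n) ℝ, X.rank ≤ I.r ∧
      d = frobNorm (I.A - X)}.Nonempty := ⟨_, 0, by simp, rfl⟩
  obtain ⟨_, ⟨X, hX, rfl⟩, hlt⟩ := exists_lt_of_csInf_lt hne (lt_add_one (bestRankError I.A I.r))
  obtain ⟨X', hX', hle⟩ := exists_rank_eq_frobNorm_le (A := I.A)
    (hX.trans (Nat.le_add_right I.r I.p)) I.le_rank
  exact ⟨X', hX', hle.trans hlt.le⟩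

theorem bestRankError_le_approxTerm : bestRankError I.A I.r ≤ I.approxTerm := by
  have h0 : 0 ≤ bestRankError I.A I.r :=
    Real.sInf_nonneg (by rintro _ ⟨X, _, rfl⟩; exact frobNorm_nonneg _)
  have hp : (2 : ℝ) ≤ I.p := by exact_mod_cast I.two_le_p
  refine le_mul_of_one_le_left h0 (Real.one_le_sqrt.2 ?_)
  have : 0 ≤ (I.r : ℝ) / ((I.p : ℝ) - 1) := div_nonneg (by positivity) (by linarith)
  linarith

/-- The coherence term is controlled by `μ₀`. -/
theorem norm_starProjection_sq_le (i : Fin I.m) :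
    ‖(colSpace I.A).starProjection (EuclideanSpace.single i (1 : ℝ))‖ ^ 2 ≤
      √(I.R * mu0 I.A / I.m) ^ 2 := by
  have hR : 0 < I.R := lt_of_lt_of_le (by have := I.four_le_k; omega) I.k_le_R
  have hm : 0 < I.m := lt_of_lt_of_le hR I.R_le_m
  rw [Real.sq_sqrt (by have := I.mu0_nonneg; positivity)]
  have h1 : (I.R : ℝ) * mu0 I.A / I.m = ⨆ j : Fin I.m,
      ‖(colSpace I.A).starProjection (EuclideanSpace.single j (1 : ℝ))‖ ^ 2 := by
    have h2 : (I.A.rank : ℝ) ≠ 0 := by exact_mod_cast hR.ne'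
    have h3 : (I.m : ℝ) ≠ 0 := by exact_mod_cast hm.ne'
    rw [mu0, R]
    field_simp
  rw [h1]
  exact le_ciSup (f := fun j : Fin I.m =>
    ‖(colSpace I.A).starProjection (EuclideanSpace.single j (1 : ℝ))‖ ^ 2)
    (Set.finite_range _).bddAbove i

/-- The condition `m ≥ 2000 R k log R` leaves enough room outside the column space of `A`. -/
theorem room_of_le (h : 2000 * ((I.R : ℝ) * I.k * Real.log I.R) ≤ I.m) :
    4 * ((sketchSize I.k : ℝ) * Real.log (161 * sketchSize I.k) + 5) ≤ (I.m : ℝ) - I.R ∧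
      (I.m : ℝ) / 2 ≤ I.m - I.R := by
  have hk : (4 : ℝ) ≤ I.k := by exact_mod_cast I.four_le_k
  have hkR : (I.k : ℝ) ≤ I.R := by exact_mod_cast I.k_le_R
  have hlogk := one_le_log I.four_le_k
  have hlog : Real.log I.k ≤ Real.log I.R := Real.log_le_log (by linarith) hkR
  have h1 := four_mul_sketchSize_mul_log_le I.four_le_k
  have h2 : (I.k : ℝ) * I.k * Real.log I.k ≤ I.R * I.k * Real.log I.R := by gcongr
  have h3 : (I.R : ℝ) ≤ I.R * I.k * Real.log I.R := by
    have : (1 : ℝ) ≤ I.k * Real.log I.R := by nlinarith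
    nlinarith
  constructor <;> linarith

theorem sketchNoise_le :
    sketchNoise I.k I.ε I.δ ≤ 84 * (√I.k * I.L / I.ε) := by
  have hk : (4 : ℝ) ≤ I.k := by exact_mod_cast I.four_le_k
  have hε := I.ε_pos
  have hlam := one_le_log_four_div I.δ_pos I.δ_lt_one
  have hL := I.one_le_L
  have h1 : √(sketchSize I.k + Real.log (4 / I.δ)) ≤ 7 * (√I.k * √I.L) := by
    rw [← Real.sqrt_mul (by positivity), Real.sqrt_le_left (by positivity), mul_pow,
      Real.sq_sqrt (by positivity)]
    have h2 := sketchSize_le I.four_le_k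
    have h3 : (I.k : ℝ) * Real.log I.k ≤ I.k * I.L := by
      gcongr
      exact I.log_k_le_L
    nlinarith [I.log_four_div_le_L]
  have h2 : √(8 * Real.log (4 / I.δ)) ≤ 3 * √I.L := by
    rw [Real.sqrt_le_left (by positivity), mul_pow, Real.sq_sqrt (by positivity)]
    linarith [I.log_four_div_le_L]
  calc sketchNoise I.k I.ε I.δ
      = 4 * (√(sketchSize I.k + Real.log (4 / I.δ)) * √(8 * Real.log (4 / I.δ))) / I.ε := by
        rw [sketchNoise, noiseRatio]
        field_simp
        norm_num
    _ ≤ 4 * (7 * (√I.k * √I.L) * (3 * √I.L)) / I.ε := by gcongr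
    _ = 84 * (√I.k * (√I.L * √I.L) / I.ε) := by ring
    _ = 84 * (√I.k * I.L / I.ε) := by rw [Real.mul_self_sqrt (by linarith)]

/-- The coherence of the sketch, compared with the second part of the noise term. -/
theorem width_mul_sqrt_sketchSize_le (hm : (I.m : ℝ) / 2 ≤ I.m - I.R) :
    (√(I.R * mu0 I.A / I.m) + √(4 * (sketchSize I.k + Real.log (100 * I.m))) /
        (√(I.m - I.R) / 8)) * √(sketchSize I.k) ≤
      1116 * (√(((I.k : ℝ) * I.R * mu0 I.A + (I.k : ℝ) ^ 2 * Real.log I.m) / I.m) *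
        √I.k * √I.L) := by
  have hk : (4 : ℝ) ≤ I.k := by exact_mod_cast I.four_le_k
  have hkm : (I.k : ℝ) ≤ I.m := by exact_mod_cast I.k_le_R.trans I.R_le_m
  have hm4 : 4 ≤ I.m := I.four_le_k.trans (I.k_le_R.trans I.R_le_m)
  have hm0 : (0 : ℝ) < I.m := by linarith
  have hL := I.one_le_L
  have hmu := I.mu0_nonneg
  have hlogm := one_le_log hm4
  have hlogk := one_le_log I.four_le_k
  have hlogkm : Real.log I.k ≤ Real.log I.m := Real.log_le_log (by linarith) hkm
  have hl := sketchSize_le I.four_le_k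
  set l : ℝ := (sketchSize I.k : ℝ) with hldef
  have hl0 : 0 ≤ l := by positivity
  set W := ((I.k : ℝ) * I.R * mu0 I.A + (I.k : ℝ) ^ 2 * Real.log I.m) / I.m with hW
  have hW0 : 0 ≤ W := by positivity
  have hlL : l ≤ 48 * (I.k * I.L) := hl.trans (by gcongr; exact I.log_k_le_L)
  have hlog100 : Real.log (100 * I.m) ≤ 5 * Real.log I.m := by
    rw [Real.log_mul (by norm_num) hm0.ne']
    have h4 := Real.log_le_log (by norm_num) (by norm_num : (100 : ℝ) ≤ 2 ^ 8)
    rw [Real.log_pow] at h4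
    push_cast at h4
    linarith [two_mul_log_two_le_log hm4]
  have hrhs : √W * √I.k * √I.L = √(W * (I.k * I.L)) := by
    rw [Real.sqrt_mul hW0, Real.sqrt_mul (by positivity), mul_assoc]
  rw [hrhs, add_mul]
  have ha : √(I.R * mu0 I.A / I.m) * √l ≤ 7 * √(W * (I.k * I.L)) := by
    rw [← Real.sqrt_mul (by positivity), Real.sqrt_le_left (by positivity), mul_pow,
      Real.sq_sqrt (by positivity)]
    have h1 : (I.R : ℝ) * mu0 I.A / I.m ≤ W := by
      rw [hW]
      gcongr
      have h2 : (I.R : ℝ) * mu0 I.A ≤ I.k * (I.R * mu0 I.A) :=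
        le_mul_of_one_le_left (by positivity) (by linarith)
      have h3 : 0 ≤ (I.k : ℝ) ^ 2 * Real.log I.m := by positivity
      linarith
    calc (I.R : ℝ) * mu0 I.A / I.m * l ≤ W * (48 * (I.k * I.L)) := by gcongr
      _ ≤ 7 ^ 2 * (W * (I.k * I.L)) := by
        have : 0 ≤ W * (I.k * I.L) := by positivity
        linarith
  have hb : √(4 * (l + Real.log (100 * I.m))) / (√(I.m - I.R) / 8) * √l ≤
      1109 * √(W * (I.k * I.L)) := by
    have h100 : 0 ≤ Real.log (100 * I.m) := Real.log_nonneg (by linarith)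
    have hmR : (0 : ℝ) < I.m - I.R := by linarith
    have h1 : √(4 * (l + Real.log (100 * I.m))) / (√(I.m - I.R) / 8) * √l =
        √(64 * (4 * (l + Real.log (100 * I.m))) / (I.m - I.R) * l) := by
      have hT : 0 ≤ 4 * (l + Real.log (100 * I.m)) := by positivity
      generalize 4 * (l + Real.log (100 * I.m)) = T at hT
      have h64 : √(64 : ℝ) = 8 := by
        rw [show (64 : ℝ) = 8 ^ 2 by norm_num]
        exact Real.sqrt_sq (by norm_num)
      rw [Real.sqrt_mul (by positivity) l, Real.sqrt_div (by positivity),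
        Real.sqrt_mul (by norm_num) T, h64]
      field_simp
    rw [h1, Real.sqrt_le_left (by positivity), mul_pow, Real.sq_sqrt (by positivity)]
    have h2 : l + Real.log (100 * I.m) ≤ 50 * (I.k * Real.log I.m) := by
      have h3 : (I.k : ℝ) * Real.log I.k ≤ I.k * Real.log I.m := by gcongr
      nlinarith
    have h4 : (I.k : ℝ) * (I.k * Real.log I.m) / I.m ≤ W := by
      rw [hW]
      gcongr
      have h3 : 0 ≤ (I.k : ℝ) * I.R * mu0 I.A := by positivity
      nlinarith
    have h5 : (I.k : ℝ) * Real.log I.m / I.m ≤ W := by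
      refine le_trans ?_ h4
      gcongr
      exact le_mul_of_one_le_left (by positivity) (by linarith)
    calc 64 * (4 * (l + Real.log (100 * I.m))) / (I.m - I.R) * l
        ≤ 64 * (4 * (50 * (I.k * Real.log I.m))) / (I.m / 2) * (48 * (I.k * I.L)) := by gcongr
      _ = 1228800 * (I.k * Real.log I.m / I.m * (I.k * I.L)) := by
          field_simp
          ring
      _ ≤ 1228800 * (W * (I.k * I.L)) := by gcongr
      _ ≤ 1109 ^ 2 * (W * (I.k * I.L)) := by
          have : 0 ≤ W * (I.k * I.L) := by positivity
          linarith
  linarith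

theorem output_ae_rank_eq : ∀ᵐ B ∂(algorithm.output I), B.rank = I.k := by
  obtain ⟨X, hX, -⟩ := I.exists_rank_eq
  exact mechanism_ae_rank_eq hX

theorem algorithm_hasError (h : 2000 * ((I.R : ℝ) * I.k * Real.log I.R) ≤ I.m) :
    algorithm.HasError I (1000000 * (I.approxTerm + I.noiseTerm)) := by
  obtain ⟨X, hX, hXle⟩ := I.exists_rank_eq
  obtain ⟨hroom, hhalf⟩ := I.room_of_le h
  have hk : (4 : ℝ) ≤ I.k := by exact_mod_cast I.four_le_k
  have hm4 : (4 : ℝ) ≤ I.m := by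
    exact_mod_cast I.four_le_k.trans (I.k_le_R.trans I.R_le_m)
  have hm0 : 0 < I.m := lt_of_lt_of_le (by norm_num) (I.four_le_k.trans (I.k_le_R.trans I.R_le_m))
  have hε := I.ε_pos
  have hL := I.one_le_L
  have hρ := noiseRatio_pos I.ε_pos I.δ_pos I.δ_lt_one
  have hlam := one_le_log_four_div I.δ_pos I.δ_lt_one
  refine mechanism_error (sketchNoise_pos _ I.ε_pos I.δ_pos I.δ_lt_one) hρ (Real.sqrt_nonneg _)
    hm0 I.A X hX (le_sketchSize I.four_le_k) hroom I.norm_starProjection_sq_le ?_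
  have hbest := I.bestRankError_le_approxTerm
  set G1 := √((I.k : ℝ) * I.m) * (I.L / I.ε) with hG1
  set W := √(((I.k : ℝ) * I.R * mu0 I.A + (I.k : ℝ) ^ 2 * Real.log I.m) / I.m) with hW
  set G2 := W * √((I.k : ℝ) * I.n) * (I.L / I.ε) with hG2
  have hnoise : I.noiseTerm = G1 + G2 := by rw [noiseTerm, hG1, hG2, add_mul]
  have hG1one : 1 ≤ G1 := by
    have h1 : 1 ≤ √((I.k : ℝ) * I.m) := Real.one_le_sqrt.2 (by nlinarith)
    have h2 : 1 ≤ I.L / I.ε := by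
      rw [one_le_div hε]
      linarith [I.ε_lt_one]
    exact one_le_mul_of_one_le_of_one_le h1 h2
  have hG2nonneg : 0 ≤ G2 := by positivity
  have hsketch : sketchNoise I.k I.ε I.δ * √I.m ≤ 84 * G1 := by
    calc sketchNoise I.k I.ε I.δ * √I.m ≤ 84 * (√I.k * I.L / I.ε) * √I.m := by
          gcongr
          exact I.sketchNoise_le
      _ = 84 * G1 := by
          rw [hG1, Real.sqrt_mul (by positivity)]
          ring
  set w := √(I.R * mu0 I.A / I.m) + √(4 * (sketchSize I.k + Real.log (100 * I.m))) /
        (√(I.m - I.R) / 8) with hw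
  have hw0 : 0 ≤ w := by positivity
  have hproj : w / noiseRatio I.ε I.δ * (10 * √(sketchSize I.k * I.n)) ≤ 66960 * G2 := by
    have h1 : 1 / noiseRatio I.ε I.δ ≤ 6 * √I.L / I.ε := by
      have h2 : √(8 * Real.log (4 / I.δ)) ≤ 3 * √I.L := by
        rw [Real.sqrt_le_left (by positivity), mul_pow, Real.sq_sqrt (by positivity)]
        linarith [I.log_four_div_le_L]
      calc 1 / noiseRatio I.ε I.δ = 2 * √(8 * Real.log (4 / I.δ)) / I.ε := by
            rw [noiseRatio]
            field_simp
        _ ≤ 2 * (3 * √I.L) / I.ε := by gcongr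
        _ = 6 * √I.L / I.ε := by ring
    calc w / noiseRatio I.ε I.δ * (10 * √(sketchSize I.k * I.n))
        = 10 * (w * √(sketchSize I.k)) * √I.n * (1 / noiseRatio I.ε I.δ) := by
          rw [Real.sqrt_mul (by positivity)]
          ring
      _ ≤ 10 * (1116 * (W * √I.k * √I.L)) * √I.n * (6 * √I.L / I.ε) := by
          refine mul_le_mul (mul_le_mul_of_nonneg_right ?_ (Real.sqrt_nonneg _)) h1
            (by positivity) (by positivity)
          exact mul_le_mul_of_nonneg_left (I.width_mul_sqrt_sketchSize_le hhalf) (by norm_num)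
      _ = 66960 * (W * (√I.k * √I.n) * ((√I.L * √I.L) / I.ε)) := by ring
      _ = 66960 * G2 := by
          rw [Real.mul_self_sqrt (by linarith), hG2, Real.sqrt_mul (by positivity)]
  have happ : 0 ≤ I.approxTerm :=
    (Real.sInf_nonneg (by rintro _ ⟨X, _, rfl⟩; exact frobNorm_nonneg _)).trans hbest
  rw [hnoise]
  change 2 * (81 * frobNorm (I.A - X) + 80 * sketchNoise I.k I.ε I.δ * √I.m +
    w / noiseRatio I.ε I.δ * (10 * √(sketchSize I.k * I.n))) + frobNorm (I.A - X) + 1 ≤ _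
  linarith

/-- The noise term is small when `m a` is small compared with `n`, and
`R k (μ₀ + log m) a` with `m`. -/
theorem noiseTerm_mul_sqrt_le {a c : ℝ} (ha : 0 ≤ a) (hc : 0 ≤ c)
    (h1 : (I.m : ℝ) * a ≤ c ^ 2 * I.n)
    (h2 : (I.R : ℝ) * I.k * (mu0 I.A + Real.log I.m) * a ≤ c ^ 2 * I.m) :
    I.noiseTerm * √a ≤ 2 * c * (√((I.k : ℝ) * I.n) * (I.L / I.ε)) := by
  have hk : (4 : ℝ) ≤ I.k := by exact_mod_cast I.four_le_k
  have hkR : (I.k : ℝ) ≤ I.R := by exact_mod_cast I.k_le_R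
  have hm4 : 4 ≤ I.m := I.four_le_k.trans (I.k_le_R.trans I.R_le_m)
  have hm0 : (0 : ℝ) < I.m := by exact_mod_cast (by omega : 0 < I.m)
  have hlogm := one_le_log hm4
  have hmu := I.mu0_nonneg
  have hL := I.one_le_L
  have hε := I.ε_pos
  have ha1 : √((I.k : ℝ) * I.m) * √a ≤ c * √((I.k : ℝ) * I.n) := by
    rw [← Real.sqrt_mul (by positivity), Real.sqrt_le_left (by positivity), mul_pow,
      Real.sq_sqrt (by positivity)]
    nlinarith
  have hb1 : √(((I.k : ℝ) * I.R * mu0 I.A + (I.k : ℝ) ^ 2 * Real.log I.m) / I.m) * √a ≤ c := by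
    rw [← Real.sqrt_mul (by positivity), Real.sqrt_le_left hc, div_mul_eq_mul_div,
      div_le_iff₀ hm0]
    refine le_trans ?_ h2
    gcongr
    have h3 : (I.k : ℝ) ^ 2 * Real.log I.m ≤ I.R * I.k * Real.log I.m := by
      rw [pow_two]
      gcongr
    linarith
  have hLε : 0 ≤ I.L / I.ε := by positivity
  have hkn : 0 ≤ √((I.k : ℝ) * I.n) := Real.sqrt_nonneg _
  calc I.noiseTerm * √a = (√((I.k : ℝ) * I.m) * √a +
        √(((I.k : ℝ) * I.R * mu0 I.A + (I.k : ℝ) ^ 2 * Real.log I.m) / I.m) * √a *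
          √((I.k : ℝ) * I.n)) * (I.L / I.ε) := by
        rw [noiseTerm]
        ring
    _ ≤ (c * √((I.k : ℝ) * I.n) + c * √((I.k : ℝ) * I.n)) * (I.L / I.ε) := by gcongr
    _ = _ := by ring

theorem noiseTerm_nonneg : 0 ≤ I.noiseTerm := by
  have := I.one_le_L
  have := I.ε_pos
  unfold noiseTerm
  positivity

/-- In the asymptotic regimes the assumption of `algorithm_hasError` holds. -/
theorem le_m_of_le {a : ℝ} (ha : 1 ≤ a)
    (h : (I.R : ℝ) * I.k * (mu0 I.A + Real.log I.m) * a ≤ 1 / 2000 * I.m) :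
    2000 * ((I.R : ℝ) * I.k * Real.log I.R) ≤ I.m := by
  have hR : 0 < I.R := lt_of_lt_of_le (by have := I.four_le_k; omega) I.k_le_R
  have hRm : (I.R : ℝ) ≤ I.m := by exact_mod_cast I.R_le_m
  have hR0 : (1 : ℝ) ≤ I.R := by exact_mod_cast hR
  have hlog : Real.log I.R ≤ Real.log I.m := Real.log_le_log (by linarith) hRm
  have hlog0 : 0 ≤ Real.log I.R := Real.log_nonneg hR0
  have hmu := I.mu0_nonneg
  have h1 : (I.R : ℝ) * I.k * Real.log I.R ≤
      (I.R : ℝ) * I.k * (mu0 I.A + Real.log I.m) * a := by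
    calc (I.R : ℝ) * I.k * Real.log I.R ≤ I.R * I.k * (mu0 I.A + Real.log I.m) * 1 := by
          rw [mul_one]
          gcongr
          linarith
      _ ≤ _ := by gcongr
  linarith

end Instance

end PrivateLowRank

theorem mainTheorem2 :
    ∃ (M : PrivateLowRank.Algorithm) (c₀ C : ℝ), 0 < c₀ ∧ 0 < C ∧
      -- `M` always outputs a random matrix and is differentially private
      (∀ (m n r p : ℕ) (ε δ : ℝ), IsMarkovKernel (M m n r p ε δ)) ∧
      (∀ (m n r p : ℕ) (ε δ : ℝ), 2 ≤ r → 2 ≤ p → 0 < ε → ε < 1 → 0 < δ → δ < 1 →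
        PrivateLowRank.IsDP ε δ (M m n r p ε δ)) ∧
      -- rank of the output and error bound
      (∀ I : PrivateLowRank.Instance,
        c₀ * ((I.R : ℝ) * I.k * Real.log I.R) ≤ I.m →
          (∀ᵐ B ∂(M.output I), B.rank = I.k) ∧
          M.HasError I (C * (I.approxTerm + I.noiseTerm))) ∧
      -- asymptotic regime, `L = log (k / δ)`
      (∀ (ι : Type) (l : Filter ι) (I : ι → PrivateLowRank.Instance),
        ((fun i => ((I i).m : ℝ)) =o[l] fun i => ((I i).n : ℝ)) →
        ((fun i => ((I i).R : ℝ) * (I i).k * (PrivateLowRank.mu0 (I i).A + Real.log (I i).m) *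
            Real.sqrt (I i).L) =o[l] fun i => ((I i).m : ℝ)) →
        ∃ η : ι → ℝ,
          (η =o[l] fun i => Real.sqrt (((I i).k : ℝ) * (I i).n) * (I i).L / (I i).ε) ∧
          ∀ᶠ i in l, M.HasError (I i) (C * (I i).approxTerm + η i)) ∧
      (∀ (ι : Type) (l : Filter ι) (I : ι → PrivateLowRank.Instance),
        ((fun i => ((I i).m : ℝ) * (I i).L) =o[l] fun i => ((I i).n : ℝ)) →
        ((fun i => ((I i).R : ℝ) * (I i).k * (PrivateLowRank.mu0 (I i).A + Real.log (I i).m) *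
            (I i).L) =o[l] fun i => ((I i).m : ℝ)) →
        ∃ η : ι → ℝ,
          (η =o[l] fun i => Real.sqrt (((I i).k : ℝ) * (I i).n * (I i).L) / (I i).ε) ∧
          ∀ᶠ i in l, M.HasError (I i) (C * (I i).approxTerm + η i)) := by
  refine ⟨PrivateLowRank.algorithm, 2000, 1000000, by norm_num, by norm_num,
    fun m n r p ε δ => PrivateLowRank.isMarkovKernel_mechanism _ _ _ _ _ _,
    fun m n r p ε δ _ _ hε hε1 hδ hδ1 => PrivateLowRank.algorithm_isDP m n r p hε hε1 hδ hδ1,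
    fun I hI => ⟨I.output_ae_rank_eq, I.algorithm_hasError hI⟩, ?_, ?_⟩
  · intro ι l I hmn hR
    refine ⟨fun i => 1000000 * (I i).noiseTerm, ?_, ?_⟩
    · refine IsLittleO.const_mul_left (isLittleO_iff.2 fun c hc => ?_) _
      have hc2 : 0 < (c / 2) ^ 2 := by positivity
      filter_upwards [isLittleO_iff.1 hmn hc2, isLittleO_iff.1 hR hc2] with i h1 h2
      have hL := (I i).one_le_L
      have hsL : 1 ≤ √(I i).L := Real.one_le_sqrt.2 hL
      rw [Real.norm_of_nonneg (by positivity), Real.norm_of_nonneg (by positivity)] at h1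
      have h2' := (le_abs_self _).trans h2
      rw [Real.norm_of_nonneg (by positivity)] at h2'
      have hmu := (I i).mu0_nonneg
      have h0 : 0 ≤ ((I i).R : ℝ) * (I i).k * (PrivateLowRank.mu0 (I i).A + Real.log (I i).m) :=
        mul_nonneg (by positivity) (add_nonneg hmu (Real.log_natCast_nonneg _))
      have h3 := (I i).noiseTerm_mul_sqrt_le (a := 1) zero_le_one (by positivity : 0 ≤ c / 2)
        (by rwa [mul_one]) (le_trans (by gcongr) h2')
      have hε := (I i).ε_pos
      rw [Real.norm_of_nonneg (I i).noiseTerm_nonneg, Real.norm_of_nonneg (by positivity)]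
      rw [Real.sqrt_one, mul_one] at h3
      calc _ ≤ _ := h3
        _ = _ := by ring
    · filter_upwards [isLittleO_iff.1 hR (by norm_num : (0 : ℝ) < 1 / 2000)] with i h
      have h' := (le_abs_self _).trans h
      rw [Real.norm_of_nonneg (by positivity)] at h'
      rw [← mul_add]
      exact (I i).algorithm_hasError
        ((I i).le_m_of_le (Real.one_le_sqrt.2 (I i).one_le_L) h')
  · intro ι l I hmn hR
    refine ⟨fun i => 1000000 * (I i).noiseTerm, ?_, ?_⟩
    · refine IsLittleO.const_mul_left (isLittleO_iff.2 fun c hc => ?_) _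
      have hc2 : 0 < (c / 2) ^ 2 := by positivity
      filter_upwards [isLittleO_iff.1 hmn hc2, isLittleO_iff.1 hR hc2] with i h1 h2
      have hL := (I i).one_le_L
      have hL0 : 0 < (I i).L := by linarith
      have h1' := (le_abs_self _).trans h1
      have h2' := (le_abs_self _).trans h2
      rw [Real.norm_of_nonneg (by positivity)] at h1' h2'
      have h3 := (I i).noiseTerm_mul_sqrt_le hL0.le (by positivity : 0 ≤ c / 2) h1' h2'
      have hε := (I i).ε_pos
      rw [Real.norm_of_nonneg (I i).noiseTerm_nonneg, Real.norm_of_nonneg (by positivity)]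
      have hsL : 0 < √(I i).L := Real.sqrt_pos.2 hL0
      refine le_of_mul_le_mul_right (h3.trans_eq ?_) hsL
      rw [Real.sqrt_mul (by positivity) (I i).L]
      nth_rw 1 [← Real.mul_self_sqrt hL0.le]
      ring
    · filter_upwards [isLittleO_iff.1 hR (by norm_num : (0 : ℝ) < 1 / 2000)] with i h
      have h' := (le_abs_self _).trans h
      rw [Real.norm_of_nonneg (by positivity)] at h'
      rw [← mul_add]
      exact (I i).algorithm_hasError ((I i).le_m_of_le (I i).one_le_L h')
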